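/- There is a real polynomial $p$ in one variable such that the following holds for every $n$ and every $\epsilon>0$. Let $\mu$ be any probability distribution over real $n\times n$ matrices that is supported on matrices of rank exactly one. Then there exist a probability distribution $\mu'$ over real $n\times n$ matrices, absolutely continuous with respect to $\mu$ and having a finite expectation $\mathbb E_{X\sim\mu'}X$, and a matrix $L$ of rank exactly one, such that \[ \Delta_{KL}(\mu'\|\mu)=\mathbb E_{X\sim\mu'}\log\frac{d\mu'}{d\mu}(X)\;\le\;\sqrt n\cdot p(1/\epsilon) \qquad\text{and}\qquad \bigl\|L-\mathbb E_{X\sim\mu'}X\bigr\|_F\le\epsilon\,\|L\|_F , \] where $\|A\|_F=\bigl(\sum_{i,j}|A_{i,j}|^2\bigr)^{1/2}$ is the Frobenius norm. -/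

import Mathlib

open MeasureTheory

-- Norms of real matrices are Frobenius norms: `‖A‖ = √(∑ i, ∑ j, |A i j| ^ 2)`.
attribute [local instance] Matrix.frobeniusNormedAddCommGroup

/-- The Borel σ-algebra on real `n × n` matrices, as the product σ-algebra over the entries. -/
instance instMeasurableSpaceRealMatrix {n : ℕ} : MeasurableSpace (Matrix (Fin n) (Fin n) ℝ) :=
  inferInstanceAs (MeasurableSpace (Fin n → Fin n → ℝ))

/-- `μ'` is a `k`-deficient reweighting of `μ`: a probability measure whose Kullback-Leibler
divergence `KL(μ' ‖ μ)` (natural logarithm) is at most `k`. For `klDiv μ' μ` to be finite, `μ'` has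
to be absolutely continuous with respect to `μ`. -/
def IsDeficientReweighting {Ω : Type*} [MeasurableSpace Ω] (k : ℝ) (μ' μ : Measure Ω) : Prop :=
  IsProbabilityMeasure μ' ∧ InformationTheory.klDiv μ' μ ≤ ENNReal.ofReal k

/-- The random matrix with law `ν` has an expectation: all its entries are integrable. -/
def HasMeanMatrix {n : ℕ} (ν : Measure (Matrix (Fin n) (Fin n) ℝ)) : Prop :=
  ∀ i j, Integrable (fun X : Matrix (Fin n) (Fin n) ℝ => X i j) ν

/-- The expectation of a random matrix with law `ν`, entry by entry. -/
noncomputable def meanMatrix {n : ℕ} (ν : Measure (Matrix (Fin n) (Fin n) ℝ)) :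
    Matrix (Fin n) (Fin n) ℝ :=
  Matrix.of fun i j => ∫ X, X i j ∂ν

/-! A rank-one matrix is `‖X‖ u vᵀ` with unit vectors `u`, `v`. Conditioning `μ` on an event `G`
costs `-log μ(G)`, so it is enough to find `G` of probability `exp (-O(√n / ε²))`, for `ε ≤ 1`, on
which the partial expectation is close to rank one.

For unit vectors weighted by a finite measure, `G` is a pair of half-spaces `⟨u, e⟩ ≥ τ`, `⟨v, f⟩ ≥
σ`. It maximizes, up to a factor 2, the mass times a reward that grows with `τ²` and `σ²` but is
bounded by `exp (2 / (κ x₀))` relative to offsets zero (`exists_isNearOptimal`). At offset zero some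
choice of signs already has a quarter of the mass, so the maximizer is not too light. If `u` were
often large in a direction orthogonal to `e`, tilting `e` that way would give a larger offset with
too much mass left. Hence, on the event, the part of `u` orthogonal to `e` has average second moment
`O(κ (τ² + x₀)²)` in every direction (`setIntegral_sq_inner_sub_le`).

Summing over `n` coordinates and using `‖u‖ = 1` forces `τ² ≥ x₀` when `x₀ = 1 / (4√n)`
(`le_sq_offset`); this is the source of `√n`. If `τ ≤ σ`, replacing `u` by its projection to `e`
then causes an average error `O(√κ τ²)`, while the resulting rank-one matrix has norm at least `τ σ`
times the mass (`exists_rank_one_approx`). The case `σ ≤ τ` is symmetric.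

The scale `‖X‖` is absorbed as a density once confined to a window. If no window of ratio `M²` is
heavy, the scales have a gap: matrices below it provide the probability of `G`, and those above it
dominate the expectation (`exists_event_scaled_rank_one_approx`). -/

section HalfSpaces

/-! ### Penalized half-spaces and their near-maximizers. -/

variable {Ω E F : Type*} [NormedAddCommGroup E] [InnerProductSpace ℝ E]
  [NormedAddCommGroup F] [InnerProductSpace ℝ F]

/-- The event that `u` and `v` lie in prescribed half-spaces. -/
def halfSpacePair (u : Ω → E) (v : Ω → F) (e : E) (f : F) (τ σ : ℝ) : Set Ω :=
  {ω | τ ≤ inner ℝ (u ω) e ∧ σ ≤ inner ℝ (v ω) f}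

/-- The penalty on the squared offset of a half-space. -/
noncomputable def offsetPenalty (κ x₀ x : ℝ) : ℝ := 1 / (κ * (x + x₀))

theorem offsetPenalty_nonneg {κ x₀ x : ℝ} (hκ : 0 < κ) (hx₀ : 0 < x₀) (hx : 0 ≤ x) :
    0 ≤ offsetPenalty κ x₀ x := by
  unfold offsetPenalty; positivity

/-- With `y = x + x₀`, this gain is about `t / (κ y²)` while `t` is below `y`, and saturates at `1 /
(κ y)`; it becomes the exponent in all tail bounds. -/
theorem offsetPenalty_sub {κ x₀ x t : ℝ} (hκ : 0 < κ) (hx₀ : 0 < x₀) (hx : 0 ≤ x) (ht : 0 ≤ t) :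
    offsetPenalty κ x₀ x - offsetPenalty κ x₀ (x + t) =
      t / (κ * (x + x₀) * ((x + x₀) + t)) := by
  unfold offsetPenalty
  have h1 : x + x₀ ≠ 0 := by positivity
  have h2 : x + x₀ + t ≠ 0 := by positivity
  have h3 : x + t + x₀ ≠ 0 := by positivity
  field_simp
  ring

theorem halfSpacePair_swap (u : Ω → E) (v : Ω → F) (e : E) (f : F) (τ σ : ℝ) :
    halfSpacePair v u f e σ τ = halfSpacePair u v e f τ σ := by
  ext ω; simp [halfSpacePair, and_comm]

variable [MeasurableSpace Ω]

/-- The penalized mass of a pair of half-spaces. -/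
noncomputable def penalizedMass (ν : Measure Ω) (u : Ω → E) (v : Ω → F) (κ x₀ : ℝ) (e : E) (f : F)
    (τ σ : ℝ) : ℝ :=
  ν.real (halfSpacePair u v e f τ σ) *
    Real.exp (-(offsetPenalty κ x₀ (τ ^ 2) + offsetPenalty κ x₀ (σ ^ 2)))

/-- The pair of half-spaces maximizes the penalized mass up to a factor of two. -/
structure IsNearOptimal (ν : Measure Ω) (u : Ω → E) (v : Ω → F) (κ x₀ : ℝ) (e : E) (f : F)
    (τ σ : ℝ) : Prop where
  norm_left : ‖e‖ = 1
  norm_right : ‖f‖ = 1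
  nonneg_left : 0 ≤ τ
  nonneg_right : 0 ≤ σ
  le_two_mul : ∀ e' f' τ' σ', ‖e'‖ = 1 → ‖f'‖ = 1 → 0 ≤ τ' → 0 ≤ σ' →
    penalizedMass ν u v κ x₀ e' f' τ' σ' ≤ 2 * penalizedMass ν u v κ x₀ e f τ σ

theorem penalizedMass_swap (ν : Measure Ω) (u : Ω → E) (v : Ω → F) (κ x₀ : ℝ) (e : E) (f : F)
    (τ σ : ℝ) : penalizedMass ν v u κ x₀ f e σ τ = penalizedMass ν u v κ x₀ e f τ σ := by
  rw [penalizedMass, penalizedMass, halfSpacePair_swap, add_comm]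

theorem IsNearOptimal.swap {ν : Measure Ω} {u : Ω → E} {v : Ω → F} {κ x₀ : ℝ} {e : E} {f : F}
    {τ σ : ℝ} (h : IsNearOptimal ν u v κ x₀ e f τ σ) : IsNearOptimal ν v u κ x₀ f e σ τ where
  norm_left := h.norm_right
  norm_right := h.norm_left
  nonneg_left := h.nonneg_right
  nonneg_right := h.nonneg_left
  le_two_mul f' e' σ' τ' hf he hσ hτ := by
    rw [penalizedMass_swap ν u v κ x₀ e' f', penalizedMass_swap ν u v κ x₀ e f]
    exact h.le_two_mul e' f' τ' σ' he hf hτ hσ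

theorem measurableSet_halfSpacePair [MeasurableSpace E] [BorelSpace E] [SecondCountableTopology E]
    [MeasurableSpace F] [BorelSpace F] [SecondCountableTopology F] {u : Ω → E} {v : Ω → F}
    (hu : Measurable u) (hv : Measurable v) (e : E) (f : F) (τ σ : ℝ) :
    MeasurableSet (halfSpacePair u v e f τ σ) := by
  rw [halfSpacePair, Set.ofPred_and]
  exact (measurableSet_le measurable_const (hu.inner measurable_const)).inter
    (measurableSet_le measurable_const (hv.inner measurable_const))

/-- One of the four sign choices makes the half-spaces through the origin heavy. -/
theorem exists_le_measureReal_halfSpacePair_zero [Nontrivial E] [Nontrivial F] (ν : Measure Ω)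
    [IsFiniteMeasure ν] (u : Ω → E) (v : Ω → F) :
    ∃ e f, ‖e‖ = 1 ∧ ‖f‖ = 1 ∧ ν.real Set.univ / 4 ≤ ν.real (halfSpacePair u v e f 0 0) := by
  obtain ⟨e, he⟩ := exists_norm_eq E zero_le_one
  obtain ⟨f, hf⟩ := exists_norm_eq F zero_le_one
  have hcov : (Set.univ : Set Ω) ⊆
      (halfSpacePair u v e f 0 0 ∪ halfSpacePair u v e (-f) 0 0) ∪
        (halfSpacePair u v (-e) f 0 0 ∪ halfSpacePair u v (-e) (-f) 0 0) := by
    intro ω _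
    simp only [halfSpacePair, Set.mem_union, Set.mem_ofPred_eq, inner_neg_right]
    rcases le_total 0 (inner ℝ (u ω) e) with h1 | h1 <;>
      rcases le_total 0 (inner ℝ (v ω) f) with h2 | h2 <;> simp [h1, h2]
  have h := (measureReal_mono (μ := ν) hcov).trans
    ((measureReal_union_le _ _).trans
      (add_le_add (measureReal_union_le _ _) (measureReal_union_le _ _)))
  by_contra! hcon
  have h1 := hcon e f he hf
  have h2 := hcon e (-f) he (by simpa using hf)
  have h3 := hcon (-e) f (by simpa using he) hf
  have h4 := hcon (-e) (-f) (by simpa using he) (by simpa using hf)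
  linarith

theorem penalizedMass_le {ν : Measure Ω} [IsFiniteMeasure ν] {u : Ω → E} {v : Ω → F} {κ x₀ : ℝ}
    (hκ : 0 < κ) (hx₀ : 0 < x₀) (e : E) (f : F) (τ σ : ℝ) :
    penalizedMass ν u v κ x₀ e f τ σ ≤ ν.real (halfSpacePair u v e f τ σ) := by
  have h1 := offsetPenalty_nonneg hκ hx₀ (sq_nonneg τ)
  have h2 := offsetPenalty_nonneg hκ hx₀ (sq_nonneg σ)
  exact mul_le_of_le_one_right measureReal_nonneg (Real.exp_le_one_iff.2 (by linarith))

/-- The supremum need not be attained, hence the factor 2. Comparison with the heavy pair at offsets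
zero, whose penalty is `2 / (κ x₀)`, bounds the mass below; the 8 is this 2 times the four sign
choices. -/
theorem exists_isNearOptimal [Nontrivial E] [Nontrivial F] (ν : Measure Ω) [IsFiniteMeasure ν]
    [NeZero ν] (u : Ω → E) (v : Ω → F) {κ x₀ : ℝ} (hκ : 0 < κ) (hx₀ : 0 < x₀) :
    ∃ e f τ σ, IsNearOptimal ν u v κ x₀ e f τ σ ∧
      Real.exp (-(2 / (κ * x₀))) / 8 * ν.real Set.univ ≤ ν.real (halfSpacePair u v e f τ σ) := by
  obtain ⟨e₀, f₀, he₀, hf₀, h₀⟩ := exists_le_measureReal_halfSpacePair_zero ν u v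
  have hν : 0 < ν.real Set.univ := by
    rw [measureReal_def, ENNReal.toReal_pos_iff]
    exact ⟨NeZero.pos _, measure_lt_top _ _⟩
  have hexp : Real.exp (-(2 / (κ * x₀))) =
      Real.exp (-(offsetPenalty κ x₀ (0 ^ 2) + offsetPenalty κ x₀ (0 ^ 2))) := by
    congr 1; unfold offsetPenalty; ring
  have href : Real.exp (-(2 / (κ * x₀))) / 4 * ν.real Set.univ ≤
      penalizedMass ν u v κ x₀ e₀ f₀ 0 0 := by
    rw [penalizedMass, hexp]
    exact (by ring : _ = _).trans_le (mul_le_mul_of_nonneg_right h₀ (Real.exp_pos _).le)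
  let S : Set ℝ := {q | ∃ e f τ σ, ‖e‖ = 1 ∧ ‖f‖ = 1 ∧ 0 ≤ τ ∧ 0 ≤ σ ∧
    q = penalizedMass ν u v κ x₀ e f τ σ}
  have hbdd : BddAbove S := by
    refine ⟨ν.real Set.univ, ?_⟩
    rintro q ⟨e, f, τ, σ, -, -, -, -, rfl⟩
    exact (penalizedMass_le hκ hx₀ e f τ σ).trans (measureReal_mono (Set.subset_univ _))
  have hmem : penalizedMass ν u v κ x₀ e₀ f₀ 0 0 ∈ S :=
    ⟨e₀, f₀, 0, 0, he₀, hf₀, le_rfl, le_rfl, rfl⟩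
  have hpos : 0 < sSup S :=
    lt_of_lt_of_le (by positivity) (href.trans (le_csSup hbdd hmem))
  obtain ⟨q, ⟨e, f, τ, σ, he, hf, hτ, hσ, rfl⟩, hq⟩ :=
    exists_lt_of_lt_csSup ⟨_, hmem⟩ (half_lt_self hpos)
  have hopt : ∀ e' f' τ' σ', ‖e'‖ = 1 → ‖f'‖ = 1 → 0 ≤ τ' → 0 ≤ σ' →
      penalizedMass ν u v κ x₀ e' f' τ' σ' ≤ 2 * penalizedMass ν u v κ x₀ e f τ σ := by
    intro e' f' τ' σ' he' hf' hτ' hσ'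
    have := le_csSup hbdd ⟨e', f', τ', σ', he', hf', hτ', hσ', rfl⟩
    linarith
  refine ⟨e, f, τ, σ, ⟨he, hf, hτ, hσ, hopt⟩, ?_⟩
  have h1 := hopt e₀ f₀ 0 0 he₀ hf₀ le_rfl le_rfl
  have h2 := penalizedMass_le (ν := ν) (u := u) (v := v) hκ hx₀ e f τ σ
  linarith

namespace IsNearOptimal

variable {ν : Measure Ω} [IsFiniteMeasure ν] {u : Ω → E} {v : Ω → F} {κ x₀ : ℝ} {e : E} {f : F}
  {τ σ : ℝ}

/-- A half-space with larger offset captures only a small part of a near-optimal pair. -/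
theorem measureReal_inter_le (h : IsNearOptimal ν u v κ x₀ e f τ σ) (hκ : 0 < κ) (hx₀ : 0 < x₀)
    {t : ℝ} (ht : 0 ≤ t) {e' : E} (he' : ‖e'‖ = 1) {S : Set Ω}
    (hS : ∀ ω ∈ halfSpacePair u v e f τ σ, ω ∈ S → √(τ ^ 2 + t) ≤ inner ℝ (u ω) e') :
    ν.real (halfSpacePair u v e f τ σ ∩ S) ≤
      2 * Real.exp (-(t / (κ * (τ ^ 2 + x₀) * ((τ ^ 2 + x₀) + t)))) *
        ν.real (halfSpacePair u v e f τ σ) := by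
  have hsub : halfSpacePair u v e f τ σ ∩ S ⊆ halfSpacePair u v e' f (√(τ ^ 2 + t)) σ :=
    fun ω hω => ⟨hS ω hω.1 hω.2, hω.1.2⟩
  have h1 := measureReal_mono (μ := ν) hsub
  have h2 := h.le_two_mul e' f (√(τ ^ 2 + t)) σ he' h.norm_right (Real.sqrt_nonneg _)
    h.nonneg_right
  rw [penalizedMass, penalizedMass, Real.sq_sqrt (by positivity), neg_add, neg_add, Real.exp_add,
    Real.exp_add, ← mul_assoc, ← mul_assoc, ← mul_assoc] at h2
  -- The penalty of `σ` occurs on both sides and cancels.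
  have h3 := le_of_mul_le_mul_right h2 (Real.exp_pos _)
  rw [← offsetPenalty_sub hκ hx₀ (sq_nonneg τ) ht]
  have h4 : Real.exp (-(offsetPenalty κ x₀ (τ ^ 2) - offsetPenalty κ x₀ (τ ^ 2 + t))) *
      Real.exp (-offsetPenalty κ x₀ (τ ^ 2 + t)) = Real.exp (-offsetPenalty κ x₀ (τ ^ 2)) := by
    rw [← Real.exp_add]; congr 1; ring
  refine h1.trans (le_of_mul_le_mul_right ?_ (Real.exp_pos (-offsetPenalty κ x₀ (τ ^ 2 + t))))
  refine h3.trans_eq ?_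
  rw [← h4]; ring

/-- The unit vector along `τ e + √t e'` has inner product at least `√(τ² + t)` with `u` wherever
`⟨u, e⟩ ≥ τ` and `⟨u, e'⟩ ≥ √t`, so it competes with `e`. -/
theorem measureReal_orthogonal_le (h : IsNearOptimal ν u v κ x₀ e f τ σ) (hκ : 0 < κ)
    (hx₀ : 0 < x₀) {t : ℝ} (ht : 0 < t) {e' : E} (he' : ‖e'‖ = 1) (horth : inner ℝ e e' = 0) :
    ν.real (halfSpacePair u v e f τ σ ∩ {ω | √t ≤ inner ℝ (u ω) e'}) ≤
      2 * Real.exp (-(t / (κ * (τ ^ 2 + x₀) * ((τ ^ 2 + x₀) + t)))) *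
        ν.real (halfSpacePair u v e f τ σ) := by
  have hpos : 0 < √(τ ^ 2 + t) := Real.sqrt_pos.2 (by positivity)
  have hnorm : ‖τ • e + √t • e'‖ = √(τ ^ 2 + t) := by
    rw [eq_comm, Real.sqrt_eq_iff_mul_self_eq (by positivity) (norm_nonneg _),
      norm_add_mul_self_real, inner_smul_left, inner_smul_right, horth, norm_smul, norm_smul,
      h.norm_left, he']
    have := Real.mul_self_sqrt ht.le
    simp only [Real.norm_eq_abs, mul_one, abs_mul_abs_self, this]
    simp [sq]
  refine h.measureReal_inter_le hκ hx₀ ht.le (e' := (√(τ ^ 2 + t))⁻¹ • (τ • e + √t • e')) ?_ ?_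
  · rw [norm_smul, hnorm, norm_inv, Real.norm_of_nonneg hpos.le, inv_mul_cancel₀ hpos.ne']
  · intro ω hω hω'
    rw [inner_smul_right, inner_add_right, inner_smul_right, inner_smul_right,
      le_inv_mul_iff₀ hpos, Real.mul_self_sqrt (by positivity)]
    have h1 : τ ^ 2 ≤ τ * inner ℝ (u ω) e := by
      rw [sq]; exact mul_le_mul_of_nonneg_left hω.1 h.nonneg_left
    have h2 : t ≤ √t * inner ℝ (u ω) e' := by
      nth_rewrite 1 [← Real.mul_self_sqrt ht.le]
      exact mul_le_mul_of_nonneg_left hω' (Real.sqrt_nonneg _)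
    linarith

end IsNearOptimal

end HalfSpaces

/-! ### From tail bounds to second moments. -/

theorem Real.exp_neg_le_two_div_sq {z : ℝ} (hz : 0 < z) : Real.exp (-z) ≤ 2 / z ^ 2 := by
  rw [Real.exp_neg, ← one_div, div_le_div_iff₀ (Real.exp_pos _) (by positivity)]
  linarith [Real.quadratic_le_exp_of_nonneg hz.le]

theorem integral_Ioc_one_div_sq_le {a : ℝ} (ha : 0 < a) (ha1 : a ≤ 1) :
    IntegrableOn (fun t : ℝ => 1 / t ^ 2) (Set.Ioc a 1) ∧
      ∫ t in Set.Ioc a 1, 1 / t ^ 2 ≤ 1 / a := by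
  have hcont : ContinuousOn (fun t : ℝ => 1 / t ^ 2) (Set.Icc a 1) :=
    continuousOn_const.div (continuousOn_id.pow 2)
      fun t ht => pow_ne_zero 2 (ha.trans_le ht.1).ne'
  refine ⟨(hcont.integrableOn_Icc).mono_set Set.Ioc_subset_Icc_self, ?_⟩
  rw [← intervalIntegral.integral_of_le ha1,
    intervalIntegral.integral_eq_sub_of_hasDerivAt (f := fun t => -t⁻¹)]
  · simp
  · intro t ht
    rw [Set.uIcc_of_le ha1] at ht
    have ht0 : t ≠ 0 := (ha.trans_le ht.1).ne'
    exact (hasDerivAt_inv ht0).neg.congr_deriv (by simp)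
  · rw [← Set.uIcc_of_le ha1] at hcont
    exact hcont.intervalIntegrable

/-- Layer-cake bound for a variable whose tail is Gaussian up to `y` and saturates beyond. -/
theorem integral_le_of_saturated_tail {Ω : Type*} [MeasurableSpace Ω] {ρ : Measure Ω}
    [IsFiniteMeasure ρ] {f : Ω → ℝ} (hf : Measurable f) (h0 : ∀ᵐ ω ∂ρ, 0 ≤ f ω)
    (h1 : ∀ᵐ ω ∂ρ, f ω ≤ 1) {κ y : ℝ} (hκ : 0 < κ) (hκ1 : κ ≤ 1) (hy : 0 < y)
    (htail : ∀ t, 0 < t →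
      ρ.real {ω | t ≤ f ω} ≤ 4 * Real.exp (-(t / (κ * y * (y + t)))) * ρ.real Set.univ) :
    ∫ ω, f ω ∂ρ ≤ 33 * κ * y ^ 2 * ρ.real Set.univ := by
  set m := ρ.real Set.univ with hm
  have hm0 : 0 ≤ m := measureReal_nonneg
  have hint : Integrable f ρ := by
    refine Integrable.of_bound hf.aestronglyMeasurable 1 ?_
    filter_upwards [h0, h1] with ω h0 h1
    rwa [Real.norm_of_nonneg h0]
  set a := κ * y ^ 2 with ha
  have ha0 : 0 < a := by positivity
  -- For `t ≤ a` the tail hypothesis is weaker than the trivial bound by the total mass, so the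
  -- layer-cake integral is split at `a`; if `a ≥ 1`, `f ≤ 1` suffices.
  rcases le_or_gt 1 a with ha1 | ha1
  · have : ∫ ω, f ω ∂ρ ≤ ∫ _, (1 : ℝ) ∂ρ := integral_mono_ae hint (integrable_const _) h1
    simp only [integral_const, smul_eq_mul, mul_one] at this
    nlinarith
  rw [hint.integral_eq_integral_Ioc_meas_le h0 h1]
  have hanti : Antitone fun t => ρ.real {ω | t ≤ f ω} :=
    fun s t hst => measureReal_mono fun ω (hω : t ≤ f ω) => hst.trans hω
  have hI : ∀ s t : ℝ, IntegrableOn (fun t => ρ.real {ω | t ≤ f ω}) (Set.Ioc s t) := fun s t =>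
    (hanti.antitoneOn _).integrableOn_isCompact isCompact_Icc |>.mono_set Set.Ioc_subset_Icc_self
  rw [← Set.Ioc_union_Ioc_eq_Ioc ha0.le ha1.le,
    setIntegral_union (Set.Ioc_disjoint_Ioc_of_le le_rfl) measurableSet_Ioc (hI _ _) (hI _ _)]
  have hfirst : ∫ t in Set.Ioc 0 a, ρ.real {ω | t ≤ f ω} ≤ a * m := by
    refine (setIntegral_mono_on (hI _ _) (integrableOn_const (C := m) measure_Ioc_lt_top.ne)
      measurableSet_Ioc fun t _ => measureReal_mono (Set.subset_univ _)).trans_eq ?_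
    simp [ha0.le]
  obtain ⟨hi, hle⟩ := integral_Ioc_one_div_sq_le ha0 ha1.le
  have hsecond : ∫ t in Set.Ioc a 1, ρ.real {ω | t ≤ f ω} ≤
      16 * κ ^ 2 * y ^ 2 * m * (y ^ 2 * (1 / a) + 1) := by
    have hi2 : IntegrableOn (fun t : ℝ => 16 * κ ^ 2 * y ^ 2 * m * (y ^ 2 * (1 / t ^ 2) + 1))
        (Set.Ioc a 1) :=
      ((hi.const_mul _).add (integrableOn_const (C := (1 : ℝ)) measure_Ioc_lt_top.ne)).const_mul _
    refine (setIntegral_mono_on (hI _ _) hi2 measurableSet_Ioc fun t ht => ?_).trans ?_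
    · have ht0 : 0 < t := ha0.trans ht.1
      have hz : 0 < t / (κ * y * (y + t)) := by positivity
      refine (htail t ht0).trans ?_
      -- This is `exp (-z) ≤ 2 / z²` together with `(y + t)² ≤ 2 (y² + t²)`.
      have hb : 4 * Real.exp (-(t / (κ * y * (y + t)))) ≤
          16 * κ ^ 2 * y ^ 2 * (y ^ 2 * (1 / t ^ 2) + 1) := by
        have e1 : 2 / (t / (κ * y * (y + t))) ^ 2 = 2 * κ ^ 2 * y ^ 2 * (y + t) ^ 2 / t ^ 2 := by
          field_simp
        have e2 : 16 * κ ^ 2 * y ^ 2 * (y ^ 2 * (1 / t ^ 2) + 1) -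
            4 * (2 * κ ^ 2 * y ^ 2 * (y + t) ^ 2 / t ^ 2) =
            8 * κ ^ 2 * y ^ 2 * (y - t) ^ 2 / t ^ 2 := by
          field_simp; ring
        have e3 : 0 ≤ 8 * κ ^ 2 * y ^ 2 * (y - t) ^ 2 / t ^ 2 := by positivity
        have := Real.exp_neg_le_two_div_sq hz
        rw [e1] at this
        linarith
      calc _ ≤ 16 * κ ^ 2 * y ^ 2 * (y ^ 2 * (1 / t ^ 2) + 1) * m :=
            mul_le_mul_of_nonneg_right hb hm0
        _ = _ := by ring
    · rw [integral_const_mul]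
      refine mul_le_mul_of_nonneg_left ?_ (by positivity)
      rw [integral_add (hi.const_mul _) (integrableOn_const (C := (1 : ℝ)) measure_Ioc_lt_top.ne),
        integral_const_mul]
      refine add_le_add (mul_le_mul_of_nonneg_left hle (by positivity)) ?_
      simp [ha1.le, ha0.le]
  have hsimp : 16 * κ ^ 2 * y ^ 2 * m * (y ^ 2 * (1 / a) + 1) =
      16 * κ * y ^ 2 * m + 16 * κ * (κ * y ^ 2 * m) := by
    rw [ha]; field_simp
  have : κ * (κ * y ^ 2 * m) ≤ 1 * (κ * y ^ 2 * m) :=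
    mul_le_mul_of_nonneg_right hκ1 (by positivity)
  rw [hsimp] at hsecond
  nlinarith

namespace IsNearOptimal

variable {Ω E F : Type*} [MeasurableSpace Ω] [NormedAddCommGroup E] [InnerProductSpace ℝ E]
  [MeasurableSpace E] [BorelSpace E] [SecondCountableTopology E]
  [NormedAddCommGroup F] [InnerProductSpace ℝ F]
  {ν : Measure Ω} [IsFiniteMeasure ν] {u : Ω → E} {v : Ω → F} {κ x₀ : ℝ} {e : E} {f : F}
  {τ σ : ℝ}

/-- Both `e'` and `-e'` obey the tilted half-space bound; the two signs turn its factor 2 into the 4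
of the tail hypothesis. -/
theorem setIntegral_sq_inner_orthogonal_le (h : IsNearOptimal ν u v κ x₀ e f τ σ)
    (hu : Measurable u) (hu1 : ∀ ω, ‖u ω‖ = 1)
    (hκ : 0 < κ) (hκ1 : κ ≤ 1) (hx₀ : 0 < x₀) {e' : E} (he' : ‖e'‖ = 1)
    (horth : inner ℝ e e' = 0) :
    ∫ ω in halfSpacePair u v e f τ σ, inner ℝ (u ω) e' ^ 2 ∂ν ≤
      33 * κ * (τ ^ 2 + x₀) ^ 2 * ν.real (halfSpacePair u v e f τ σ) := by
  have hmeas : Measurable fun ω => inner ℝ (u ω) e' := hu.inner measurable_const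
  have huniv : (ν.restrict (halfSpacePair u v e f τ σ)).real Set.univ =
    ν.real (halfSpacePair u v e f τ σ) := by simp
  rw [← huniv]
  refine integral_le_of_saturated_tail (hmeas.pow_const 2)
    (Filter.Eventually.of_forall fun ω => sq_nonneg _)
    (Filter.Eventually.of_forall fun ω => ?_) hκ hκ1 (by positivity) fun t ht => ?_
  · have := abs_real_inner_le_norm (u ω) e'
    rw [hu1, he', mul_one] at this
    exact (sq_le_one_iff_abs_le_one _).2 this
  · rw [huniv, measureReal_restrict_apply (measurableSet_le measurable_const (hmeas.pow_const 2)),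
      Set.inter_comm]
    have hsub : halfSpacePair u v e f τ σ ∩ {ω | t ≤ inner ℝ (u ω) e' ^ 2} ⊆
        (halfSpacePair u v e f τ σ ∩ {ω | √t ≤ inner ℝ (u ω) e'}) ∪
          (halfSpacePair u v e f τ σ ∩ {ω | √t ≤ inner ℝ (u ω) (-e')}) := by
      rw [← Set.inter_union_distrib_left]
      refine Set.inter_subset_inter_right _ fun ω (hω : t ≤ inner ℝ (u ω) e' ^ 2) => ?_
      have := Real.abs_le_sqrt (x := √t) (y := inner ℝ (u ω) e' ^ 2)
        (by rwa [Real.sq_sqrt ht.le])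
      rw [abs_of_nonneg (Real.sqrt_nonneg _), Real.sqrt_sq_eq_abs, le_abs] at this
      simpa [inner_neg_right] using this
    have h1 := h.measureReal_orthogonal_le hκ hx₀ ht he' horth
    have h2 := h.measureReal_orthogonal_le hκ hx₀ ht (e' := -e') (by simpa using he')
      (by simpa [inner_neg_right] using horth)
    linarith [(measureReal_mono (μ := ν) hsub).trans (measureReal_union_le _ _)]

/-- Here the competitor keeps the direction `e` and only raises the offset. The trace argument needs
this to know that `⟨u, e⟩²` is hardly larger than `τ²` on average. -/
theorem setIntegral_sq_inner_self_le [MeasurableSpace F] [BorelSpace F]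
    [SecondCountableTopology F] (h : IsNearOptimal ν u v κ x₀ e f τ σ) (hu : Measurable u)
    (hv : Measurable v) (hu1 : ∀ ω, ‖u ω‖ = 1)
    (hκ : 0 < κ) (hκ1 : κ ≤ 1) (hx₀ : 0 < x₀) :
    ∫ ω in halfSpacePair u v e f τ σ, (inner ℝ (u ω) e ^ 2 - τ ^ 2) ∂ν ≤
      33 * κ * (τ ^ 2 + x₀) ^ 2 * ν.real (halfSpacePair u v e f τ σ) := by
  have hmeas : Measurable fun ω => inner ℝ (u ω) e := hu.inner measurable_const
  have huniv : (ν.restrict (halfSpacePair u v e f τ σ)).real Set.univ =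
    ν.real (halfSpacePair u v e f τ σ) := by simp
  have hA := measurableSet_halfSpacePair hu hv e f τ σ
  rw [← huniv]
  refine integral_le_of_saturated_tail ((hmeas.pow_const 2).sub_const _) ?_
    (Filter.Eventually.of_forall fun ω => ?_) hκ hκ1 (by positivity) fun t ht => ?_
  · filter_upwards [ae_restrict_mem hA] with ω hω
    exact sub_nonneg.2 (pow_le_pow_left₀ h.nonneg_left hω.1 2)
  · have := abs_real_inner_le_norm (u ω) e
    rw [hu1, h.norm_left, mul_one] at this
    linarith [(sq_le_one_iff_abs_le_one _).2 this, sq_nonneg τ]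
  · rw [huniv, measureReal_restrict_apply
      (measurableSet_le measurable_const ((hmeas.pow_const 2).sub_const _)), Set.inter_comm]
    have h1 := h.measureReal_inter_le hκ hx₀ ht.le h.norm_left
      (S := {ω | t ≤ inner ℝ (u ω) e ^ 2 - τ ^ 2}) fun ω hω (hω' : t ≤ _) =>
        Real.sqrt_le_iff.2 ⟨h.nonneg_left.trans hω.1, by linarith⟩
    have : 0 ≤ Real.exp (-(t / (κ * (τ ^ 2 + x₀) * ((τ ^ 2 + x₀) + t)))) *
        ν.real (halfSpacePair u v e f τ σ) := by positivity
    linarith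

/-- The component of `u` orthogonal to `e` has small second moment in every direction. -/
theorem setIntegral_sq_inner_sub_le (h : IsNearOptimal ν u v κ x₀ e f τ σ)
    (hu : Measurable u) (hu1 : ∀ ω, ‖u ω‖ = 1)
    (hκ : 0 < κ) (hκ1 : κ ≤ 1) (hx₀ : 0 < x₀) (w : E) :
    ∫ ω in halfSpacePair u v e f τ σ, inner ℝ (u ω - (inner ℝ (u ω) e : ℝ) • e) w ^ 2 ∂ν ≤
      33 * κ * (τ ^ 2 + x₀) ^ 2 * ν.real (halfSpacePair u v e f τ σ) * ‖w‖ ^ 2 := by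
  set w' := w - (inner ℝ e w : ℝ) • e with hw'
  have hee : inner ℝ e e = 1 := by rw [real_inner_self_eq_norm_sq, h.norm_left]; norm_num
  have horth : inner ℝ e w' = 0 := by
    rw [hw', inner_sub_right, inner_smul_right, hee]; ring
  have hswap : ∀ ω, inner ℝ (u ω - (inner ℝ (u ω) e : ℝ) • e) w = inner ℝ (u ω) w' := fun ω => by
    rw [hw', inner_sub_left, inner_sub_right, inner_smul_left, inner_smul_right]
    simp [mul_comm]
  have hnorm : ‖w'‖ ^ 2 ≤ ‖w‖ ^ 2 := by
    have : ‖w'‖ ^ 2 = ‖w‖ ^ 2 - inner ℝ e w ^ 2 := by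
      rw [hw', norm_sub_sq_real, inner_smul_right, norm_smul, h.norm_left, real_inner_comm w e,
        Real.norm_eq_abs, mul_one, sq_abs]
      ring
    nlinarith [sq_nonneg (inner ℝ e w)]
  simp_rw [hswap]
  have hc : 0 ≤ 33 * κ * (τ ^ 2 + x₀) ^ 2 * ν.real (halfSpacePair u v e f τ σ) := by positivity
  refine le_trans ?_ (mul_le_mul_of_nonneg_left hnorm hc)
  rcases eq_or_ne w' 0 with h0 | h0
  · simp [h0]
  have hpos : 0 < ‖w'‖ := norm_pos_iff.2 h0
  have := h.setIntegral_sq_inner_orthogonal_le hu hu1 hκ hκ1 hx₀ (e' := ‖w'‖⁻¹ • w')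
    (by rw [norm_smul, norm_inv, norm_norm, inv_mul_cancel₀ hpos.ne'])
    (by rw [inner_smul_right, horth, mul_zero])
  simp_rw [inner_smul_right, mul_pow] at this
  rw [integral_const_mul, inv_pow, inv_mul_le_iff₀ (by positivity)] at this
  linarith

end IsNearOptimal

/-! ### Frobenius norms and cross moments. -/

theorem Matrix.frobenius_norm_sq {m n : Type*} [Fintype m] [Fintype n] (A : Matrix m n ℝ) :
    ‖A‖ ^ 2 = ∑ i, ∑ j, A i j ^ 2 := by
  rw [Matrix.frobenius_norm_def, ← Real.sqrt_eq_rpow, Real.sq_sqrt (by positivity)]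
  simp

theorem Matrix.rank_vecMulVec_eq_one {m n : Type*} [Fintype m] [Fintype n] {a : m → ℝ}
    {b : n → ℝ} (h : Matrix.vecMulVec a b ≠ 0) : (Matrix.vecMulVec a b).rank = 1 := by
  refine le_antisymm (Matrix.rank_vecMulVec_le a b) (Nat.one_le_iff_ne_zero.2 fun h0 => h ?_)
  have hrange : LinearMap.range (Matrix.vecMulVec a b).mulVecLin = ⊥ :=
    Submodule.finrank_eq_zero.1 h0
  rw [LinearMap.range_eq_bot] at hrange
  classical
  exact Matrix.toLin'.injective (by simpa [Matrix.toLin'_apply'] using hrange)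

section Bounded

variable {Ω : Type*} [MeasurableSpace Ω] {n : ℕ} {u v : Ω → EuclideanSpace ℝ (Fin n)}

theorem EuclideanSpace.abs_apply_le_norm {ι : Type*} [Fintype ι] (x : EuclideanSpace ℝ ι) (i : ι) :
    |x i| ≤ ‖x‖ := by
  simpa using PiLp.norm_apply_le x i

theorem measurable_euclideanSpace_apply (hu : Measurable u) (i : Fin n) :
    Measurable fun ω => u ω i :=
  (EuclideanSpace.proj (𝕜 := ℝ) i).continuous.measurable.comp hu

theorem integrable_apply_mul_apply {ρ : Measure Ω} [IsFiniteMeasure ρ] (hu : Measurable u)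
    (hv : Measurable v) {a b : ℝ} (hua : ∀ ω, ‖u ω‖ ≤ a) (hvb : ∀ ω, ‖v ω‖ ≤ b) (i j : Fin n) :
    Integrable (fun ω => u ω i * v ω j) ρ := by
  refine Integrable.of_bound ((measurable_euclideanSpace_apply hu i).mul
    (measurable_euclideanSpace_apply hv j)).aestronglyMeasurable (a * b)
    (Filter.Eventually.of_forall fun ω => ?_)
  rw [norm_mul]
  exact mul_le_mul ((EuclideanSpace.abs_apply_le_norm _ _).trans (hua ω))
    ((EuclideanSpace.abs_apply_le_norm _ _).trans (hvb ω)) (norm_nonneg _)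
    ((norm_nonneg _).trans (hua ω))

/-- If `u` has second moment at most `Q` in every direction and `v` is a unit vector, then the
cross moment of `u` and `v` is at most `√(Q ρ(Ω))` in Frobenius norm. -/
theorem sum_sq_integral_mul_le {ρ : Measure Ω} [IsFiniteMeasure ρ] (hu : Measurable u)
    (hv : Measurable v) {a : ℝ} (hua : ∀ ω, ‖u ω‖ ≤ a) (hv1 : ∀ ω, ‖v ω‖ = 1) {Q : ℝ} (hQ : 0 < Q)
    (hmom : ∀ w, ∫ ω, inner ℝ (u ω) w ^ 2 ∂ρ ≤ Q * ‖w‖ ^ 2) :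
    ∑ i, ∑ j, (∫ ω, u ω i * v ω j ∂ρ) ^ 2 ≤ Q * ρ.real Set.univ := by
  have hint := fun i j => integrable_apply_mul_apply (ρ := ρ) hu hv hua (fun ω => (hv1 ω).le) i j
  have hvint : ∀ j, Integrable (fun ω => v ω j ^ 2) ρ := fun j => by
    simpa [sq] using integrable_apply_mul_apply (ρ := ρ) hv hv (fun ω => (hv1 ω).le)
      (fun ω => (hv1 ω).le) j j
  have huint : ∀ w, Integrable (fun ω => inner ℝ (u ω) w ^ 2) ρ := fun w => by
    refine Integrable.of_bound ((hu.inner measurable_const).pow_const 2).aestronglyMeasurable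
      ((a * ‖w‖) ^ 2) (Filter.Eventually.of_forall fun ω => ?_)
    rw [norm_pow]
    exact pow_le_pow_left₀ (norm_nonneg _) ((norm_inner_le_norm _ _).trans
      (mul_le_mul_of_nonneg_right (hua ω) (norm_nonneg _))) 2
  have hcol : ∀ j, ∑ i, (∫ ω, u ω i * v ω j ∂ρ) ^ 2 ≤ Q * ∫ ω, v ω j ^ 2 ∂ρ := by
    intro j
    -- The column itself is the test direction: weighted AM-GM bounds `‖w‖²` by `‖w‖² / 2` plus a
    -- multiple of the second moment of `v j`, and the first term is absorbed.
    let w : EuclideanSpace ℝ (Fin n) := WithLp.toLp 2 fun i => ∫ ω, u ω i * v ω j ∂ρ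
    have hw : ‖w‖ ^ 2 = ∑ i, (∫ ω, u ω i * v ω j ∂ρ) ^ 2 := by
      simp [EuclideanSpace.norm_sq_eq, w]
    have hinner : ∀ ω, inner ℝ (u ω) w * v ω j = ∑ i, w i * (u ω i * v ω j) := fun ω => by
      rw [PiLp.inner_apply, Finset.sum_mul]
      exact Finset.sum_congr rfl fun i _ => by simp [mul_assoc]
    have hsum : ‖w‖ ^ 2 = ∫ ω, inner ℝ (u ω) w * v ω j ∂ρ := by
      simp_rw [hinner]
      rw [integral_finsetSum _ fun i _ => (hint i j).const_mul _, hw]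
      exact Finset.sum_congr rfl fun i _ => by rw [integral_const_mul, sq]
    have hle : ∫ ω, inner ℝ (u ω) w * v ω j ∂ρ ≤
        ∫ ω, (1 / (2 * Q) * inner ℝ (u ω) w ^ 2 + Q / 2 * v ω j ^ 2) ∂ρ := by
      refine integral_mono ?_ (((huint w).const_mul _).add ((hvint j).const_mul _)) fun ω => ?_
      · simp_rw [hinner]
        exact integrable_finsetSum _ fun i _ => (hint i j).const_mul _
      · have : 1 / (2 * Q) * inner ℝ (u ω) w ^ 2 + Q / 2 * v ω j ^ 2 - inner ℝ (u ω) w * v ω j =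
            1 / (2 * Q) * (inner ℝ (u ω) w - Q * v ω j) ^ 2 := by
          field_simp; ring
        have h0 : 0 ≤ 1 / (2 * Q) * (inner ℝ (u ω) w - Q * v ω j) ^ 2 := by positivity
        dsimp only
        linarith
    rw [integral_add ((huint w).const_mul _) ((hvint j).const_mul _), integral_const_mul,
      integral_const_mul] at hle
    have h2 := mul_le_mul_of_nonneg_left (hmom w) (by positivity : 0 ≤ 1 / (2 * Q))
    have h3 : 1 / (2 * Q) * (Q * ‖w‖ ^ 2) = ‖w‖ ^ 2 / 2 := by field_simp
    rw [← hw]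
    linarith
  rw [Finset.sum_comm]
  refine (Finset.sum_le_sum fun j _ => hcol j).trans_eq ?_
  rw [← Finset.mul_sum, ← integral_finsetSum _ fun j _ => hvint j]
  have : ∀ ω, ∑ j, v ω j ^ 2 = 1 := fun ω => by
    have := EuclideanSpace.real_norm_sq_eq (v ω)
    rw [hv1] at this
    linarith
  simp [this]

theorem norm_sub_inner_smul_sq {E : Type*} [NormedAddCommGroup E] [InnerProductSpace ℝ E] (x : E)
    {e : E} (he : ‖e‖ = 1) : ‖x - (inner ℝ x e : ℝ) • e‖ ^ 2 = ‖x‖ ^ 2 - inner ℝ x e ^ 2 := by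
  rw [norm_sub_sq_real, inner_smul_right, norm_smul, he, Real.norm_eq_abs, mul_one, sq_abs]
  ring

end Bounded

/-! ### Rank-one approximation for unit vectors. -/

namespace IsNearOptimal

variable {Ω : Type*} [MeasurableSpace Ω] {n : ℕ} {ν : Measure Ω} [IsFiniteMeasure ν]
  {u v : Ω → EuclideanSpace ℝ (Fin n)} {κ x₀ : ℝ} {e f : EuclideanSpace ℝ (Fin n)} {τ σ : ℝ}

/-- A trace argument: the offsets of a near-optimal pair are not too small. -/
theorem le_sq_offset (h : IsNearOptimal ν u v κ x₀ e f τ σ)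
    (hu : Measurable u) (hv : Measurable v) (hu1 : ∀ ω, ‖u ω‖ = 1)
    (hκ : 0 < κ) (hκ1 : κ ≤ 1 / 40) (hx₀ : 0 < x₀) (hn : 1 ≤ n) (hnx : n * x₀ ^ 2 = 1 / 16)
    (hpos : 0 < ν.real (halfSpacePair u v e f τ σ)) : x₀ ≤ τ ^ 2 := by
  set A := halfSpacePair u v e f τ σ with hA
  set N := ν.real A with hN
  set p : Ω → EuclideanSpace ℝ (Fin n) := fun ω => u ω - (inner ℝ (u ω) e : ℝ) • e with hp
  have hpm : Measurable p := hu.sub ((hu.inner measurable_const).smul_const e)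
  have hp2 : ∀ ω, ‖p ω‖ ^ 2 = 1 - inner ℝ (u ω) e ^ 2 := fun ω => by
    rw [hp, norm_sub_inner_smul_sq _ h.norm_left, hu1, one_pow]
  have hp1 : ∀ ω, ‖p ω‖ ≤ 1 := fun ω => by
    have := hp2 ω
    exact (sq_le_one_iff₀ (norm_nonneg _)).1 (by nlinarith [sq_nonneg (inner ℝ (u ω) e)])
  have hint : ∀ i, Integrable (fun ω => p ω i ^ 2) (ν.restrict A) := fun i => by
    simpa [sq] using integrable_apply_mul_apply (ρ := ν.restrict A) hpm hpm hp1 hp1 i i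
  have hcoord : ∀ i, ∫ ω in A, p ω i ^ 2 ∂ν ≤ 33 * κ * (τ ^ 2 + x₀) ^ 2 * N := fun i => by
    have hle : ∫ ω in A, inner ℝ (p ω) (EuclideanSpace.single i 1) ^ 2 ∂ν ≤
        33 * κ * (τ ^ 2 + x₀) ^ 2 * N * ‖EuclideanSpace.single i (1 : ℝ)‖ ^ 2 :=
      h.setIntegral_sq_inner_sub_le hu hu1 hκ (by linarith) hx₀ _
    have heq : ∀ ω, inner ℝ (p ω) (EuclideanSpace.single i 1) = p ω i := fun ω => by
      rw [EuclideanSpace.inner_single_right]; simp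
    simp_rw [heq] at hle
    simpa only [PiLp.norm_single, norm_one, one_pow, mul_one] using hle
  have hsum : ∫ ω in A, (1 - inner ℝ (u ω) e ^ 2) ∂ν ≤ n * (33 * κ * (τ ^ 2 + x₀) ^ 2 * N) := by
    simp_rw [← hp2, EuclideanSpace.real_norm_sq_eq]
    rw [integral_finsetSum _ fun i _ => hint i]
    exact (Finset.sum_le_sum fun i _ => hcoord i).trans_eq (by simp)
  have hrad := h.setIntegral_sq_inner_self_le hu hv hu1 hκ (by linarith) hx₀
  have hsq : Integrable (fun ω => inner ℝ (u ω) e ^ 2) (ν.restrict A) := by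
    refine Integrable.of_bound ((hu.inner measurable_const).pow_const 2).aestronglyMeasurable 1
      (Filter.Eventually.of_forall fun ω => ?_)
    rw [norm_pow]
    refine pow_le_one₀ (norm_nonneg _) ((norm_inner_le_norm _ _).trans ?_)
    rw [hu1, h.norm_left, one_mul]
  rw [integral_sub (integrable_const _) hsq] at hsum
  rw [integral_sub hsq (integrable_const _)] at hrad
  simp only [integral_const, measureReal_restrict_apply_univ, smul_eq_mul, mul_one,
    ← hA, ← hN] at hsum hrad
  by_contra! hcon
  have hn' : (1 : ℝ) ≤ n := by exact_mod_cast hn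
  have hy : (τ ^ 2 + x₀) ^ 2 ≤ 4 * x₀ ^ 2 := by nlinarith [sq_nonneg τ]
  have hx1 : x₀ ≤ 1 / 4 := by nlinarith
  have hny : n * (τ ^ 2 + x₀) ^ 2 ≤ 1 / 4 := by nlinarith
  have hy1 : (τ ^ 2 + x₀) ^ 2 ≤ 1 / 4 := by nlinarith
  -- The parts of `u` along and orthogonal to `e` have squared norms adding to 1. If `τ² < x₀`, the
  -- bracket is at most `1/4 + 33/80 < 1`.
  have key : N ≤ (τ ^ 2 + 33 * κ * ((τ ^ 2 + x₀) ^ 2 + n * (τ ^ 2 + x₀) ^ 2)) * N := by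
    nlinarith
  have h1 : 1 ≤ τ ^ 2 + 33 * κ * ((τ ^ 2 + x₀) ^ 2 + n * (τ ^ 2 + x₀) ^ 2) :=
    le_of_mul_le_mul_right (by linarith) hpos
  have h2 : κ * ((τ ^ 2 + x₀) ^ 2 + n * (τ ^ 2 + x₀) ^ 2) ≤ 1 / 40 * (1 / 2) :=
    mul_le_mul hκ1 (by linarith) (by positivity) (by norm_num)
  linarith

/-- On a near-optimal pair of half-spaces with `τ ≤ σ`, the first moment of `u vᵀ` is close to the
rank-one matrix obtained by projecting `u` to the line of `e`. -/
theorem exists_rank_one_approx (h : IsNearOptimal ν u v κ x₀ e f τ σ)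
    (hu : Measurable u) (hv : Measurable v) (hu1 : ∀ ω, ‖u ω‖ = 1) (hv1 : ∀ ω, ‖v ω‖ = 1)
    (hκ : 0 < κ) (hκ1 : κ ≤ 1) (hx₀ : 0 < x₀) {ε : ℝ} (hε : 0 < ε) (hκε : 528 * κ ≤ ε ^ 2)
    (hpos : 0 < ν.real (halfSpacePair u v e f τ σ)) (hτ : x₀ ≤ τ ^ 2) (hτσ : τ ≤ σ) :
    ∃ L : Matrix (Fin n) (Fin n) ℝ, L.rank = 1 ∧
      x₀ * ν.real (halfSpacePair u v e f τ σ) ≤ ‖L‖ ∧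
      ‖L - Matrix.of fun i j => ∫ ω in halfSpacePair u v e f τ σ, u ω i * v ω j ∂ν‖ ≤
        ε / 2 * ‖L‖ := by
  set A := halfSpacePair u v e f τ σ with hA
  have hAm : MeasurableSet A := measurableSet_halfSpacePair hu hv e f τ σ
  set N := ν.real A with hN
  set p : Ω → EuclideanSpace ℝ (Fin n) := fun ω => u ω - (inner ℝ (u ω) e : ℝ) • e with hp
  have hpm : Measurable p := hu.sub ((hu.inner measurable_const).smul_const e)
  have hp1 : ∀ ω, ‖p ω‖ ≤ 1 := fun ω => by
    have := norm_sub_inner_smul_sq (u ω) h.norm_left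
    rw [hu1] at this
    exact (sq_le_one_iff₀ (norm_nonneg _)).1 (by nlinarith [sq_nonneg (inner ℝ (u ω) e)])
  have hIp := fun i j => integrable_apply_mul_apply (ρ := ν.restrict A) hpm hv hp1
    (fun ω => (hv1 ω).le) i j
  have hQ : 0 < 33 * κ * (τ ^ 2 + x₀) ^ 2 * N := by positivity
  have hD := sum_sq_integral_mul_le (ρ := ν.restrict A) hpm hv hp1 hv1 hQ
    (h.setIntegral_sq_inner_sub_le hu hu1 hκ hκ1 hx₀)
  rw [measureReal_restrict_apply_univ, ← hN] at hD
  have hIe : ∀ j, Integrable (fun ω => inner ℝ (u ω) e * v ω j) (ν.restrict A) := fun j => by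
    refine Integrable.of_bound ((hu.inner measurable_const).mul
      (measurable_euclideanSpace_apply hv j)).aestronglyMeasurable 1
      (Filter.Eventually.of_forall fun ω => ?_)
    rw [norm_mul]
    refine mul_le_one₀ ((norm_inner_le_norm _ _).trans ?_) (norm_nonneg _)
      ((EuclideanSpace.abs_apply_le_norm _ _).trans (hv1 ω).le)
    rw [hu1, h.norm_left, one_mul]
  -- The approximant is `e wᵀ`; pairing `w` with `f` bounds its norm below, since both inner
  -- products are large on `A`.
  let w : EuclideanSpace ℝ (Fin n) := WithLp.toLp 2 fun j => ∫ ω in A, inner ℝ (u ω) e * v ω j ∂ν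
  have hw : τ * σ * N ≤ ‖w‖ := by
    have h1 : inner ℝ w f = ∫ ω in A, inner ℝ (u ω) e * inner ℝ (v ω) f ∂ν := by
      have hin : ∀ ω, inner ℝ (u ω) e * inner ℝ (v ω) f =
          ∑ j, f j * (inner ℝ (u ω) e * v ω j) := fun ω => by
        rw [PiLp.inner_apply (v ω), Finset.mul_sum]
        exact Finset.sum_congr rfl fun j _ => by simp; ring
      simp_rw [hin]
      rw [integral_finsetSum _ fun j _ => (hIe j).const_mul _, PiLp.inner_apply]
      exact Finset.sum_congr rfl fun j _ => by rw [integral_const_mul]; simp [w]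
    have h2 : τ * σ * N ≤ inner ℝ w f := by
      rw [h1]
      have hint : Integrable (fun ω => inner ℝ (u ω) e * inner ℝ (v ω) f) (ν.restrict A) := by
        refine Integrable.of_bound ((hu.inner measurable_const).mul
          (hv.inner measurable_const)).aestronglyMeasurable 1
          (Filter.Eventually.of_forall fun ω => ?_)
        rw [norm_mul]
        refine mul_le_one₀ ((norm_inner_le_norm _ _).trans ?_) (norm_nonneg _)
          ((norm_inner_le_norm _ _).trans ?_)
        · rw [hu1, h.norm_left, one_mul]
        · rw [hv1, h.norm_right, one_mul]
      have := setIntegral_mono_on (μ := ν) (f := fun _ => τ * σ) (integrable_const _) hint hAm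
        fun ω hω => mul_le_mul hω.1 hω.2 h.nonneg_right (h.nonneg_left.trans hω.1)
      simpa [← hN, mul_comm] using this
    refine h2.trans ((real_inner_le_norm _ _).trans_eq ?_)
    rw [h.norm_right, mul_one]
  have hτ0 : 0 < τ := by
    rcases h.nonneg_left.eq_or_lt with h0 | h0
    · rw [← h0] at hτ; norm_num at hτ; linarith
    · exact h0
  have hLn : ‖Matrix.vecMulVec (⇑e) (⇑w)‖ = ‖w‖ := by
    have : ‖Matrix.vecMulVec (⇑e) (⇑w)‖ ^ 2 = ‖w‖ ^ 2 := by
      rw [Matrix.frobenius_norm_sq]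
      simp only [Matrix.vecMulVec_apply, mul_pow]
      rw [← Finset.sum_mul_sum, ← EuclideanSpace.real_norm_sq_eq, ← EuclideanSpace.real_norm_sq_eq,
        h.norm_left]
      ring
    exact (pow_left_inj₀ (norm_nonneg _) (norm_nonneg _) two_ne_zero).1 this
  have hσ0 : 0 < σ := hτ0.trans_le hτσ
  have hττ : τ ^ 2 ≤ τ * σ := by rw [sq]; exact mul_le_mul_of_nonneg_left hτσ hτ0.le
  have hwpos : 0 < ‖w‖ := lt_of_lt_of_le (by positivity) hw
  refine ⟨Matrix.vecMulVec e w, Matrix.rank_vecMulVec_eq_one ?_, ?_, ?_⟩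
  · rw [← norm_pos_iff, hLn]; exact hwpos
  · rw [hLn]
    exact (mul_le_mul_of_nonneg_right (hτ.trans hττ) hpos.le).trans hw
  · rw [hLn, norm_sub_rev]
    have hdiff : (Matrix.of fun i j => ∫ ω in A, u ω i * v ω j ∂ν) - Matrix.vecMulVec e w =
        Matrix.of fun i j => ∫ ω in A, p ω i * v ω j ∂ν := by
      ext i j
      have hpt : ∀ ω, u ω i * v ω j = p ω i * v ω j + e i * (inner ℝ (u ω) e * v ω j) := fun ω => by
        simp only [hp, PiLp.sub_apply, PiLp.smul_apply, smul_eq_mul]; ring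
      simp only [Matrix.sub_apply, Matrix.of_apply, Matrix.vecMulVec_apply]
      simp_rw [hpt]
      rw [integral_add (hIp i j) ((hIe j).const_mul _), integral_const_mul]
      simp [w]
    rw [hdiff]
    refine abs_le_of_sq_le_sq' ?_ (by positivity) |>.2
    rw [Matrix.frobenius_norm_sq]
    refine hD.trans ?_
    -- Both `x₀ ≤ τ²` and `τ ≤ σ` enter here. The constant `528 = 33 · 4 · 4` collects this 4 and
    -- the one from `(ε / 2)²`.
    have hy : (τ ^ 2 + x₀) ^ 2 ≤ 4 * (τ * σ) ^ 2 := by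
      have : τ ^ 2 + x₀ ≤ 2 * (τ * σ) := by linarith
      nlinarith [this, sq_nonneg τ]
    calc 33 * κ * (τ ^ 2 + x₀) ^ 2 * N * N = 33 * κ * N ^ 2 * (τ ^ 2 + x₀) ^ 2 := by ring
      _ ≤ 33 * κ * N ^ 2 * (4 * (τ * σ) ^ 2) := mul_le_mul_of_nonneg_left hy (by positivity)
      _ = 528 * κ * (τ * σ * N) ^ 2 / 4 := by ring
      _ ≤ ε ^ 2 * ‖w‖ ^ 2 / 4 := by
        have : (τ * σ * N) ^ 2 ≤ ‖w‖ ^ 2 :=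
          pow_le_pow_left₀ (by nlinarith [sq_nonneg τ]) hw 2
        have := mul_le_mul hκε this (sq_nonneg _) (sq_nonneg _)
        linarith
      _ = (ε / 2 * ‖w‖) ^ 2 := by ring

end IsNearOptimal

/-- Any measure on pairs of unit vectors of `ℝⁿ` has an event of mass `exp (-O(√n / ε²))` on which
the first moment of `u vᵀ` is `ε / 2`-close to a rank-one matrix. -/
theorem exists_event_rank_one_approx {Ω : Type*} [MeasurableSpace Ω] {n : ℕ} (hn : 1 ≤ n)
    (ν : Measure Ω) [IsFiniteMeasure ν] [NeZero ν] {u v : Ω → EuclideanSpace ℝ (Fin n)}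
    (hu : Measurable u) (hv : Measurable v) (hu1 : ∀ ω, ‖u ω‖ = 1) (hv1 : ∀ ω, ‖v ω‖ = 1)
    {ε : ℝ} (hε : 0 < ε) (hε1 : ε ≤ 1) :
    ∃ A, MeasurableSet A ∧
      Real.exp (-(4800 * √n / ε ^ 2)) / 8 * ν.real Set.univ ≤ ν.real A ∧
      ∃ L : Matrix (Fin n) (Fin n) ℝ, L.rank = 1 ∧ 1 / (4 * √n) * ν.real A ≤ ‖L‖ ∧
        ‖L - Matrix.of fun i j => ∫ ω in A, u ω i * v ω j ∂ν‖ ≤ ε / 2 * ‖L‖ := by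
  have : NeZero n := ⟨by omega⟩
  have hn' : 0 < √(n : ℝ) := Real.sqrt_pos.2 (by exact_mod_cast hn)
  -- The choice `κ = ε² / 600` meets both `528 κ ≤ ε²` and `κ ≤ 1 / 40`.
  have hκ : 0 < ε ^ 2 / 600 := by positivity
  have hε2 : ε ^ 2 ≤ 1 := pow_le_one₀ hε.le hε1
  have hκ1 : ε ^ 2 / 600 ≤ 1 / 40 := by linarith
  have hx₀ : 0 < 1 / (4 * √(n : ℝ)) := by positivity
  have hnx : (n : ℝ) * (1 / (4 * √(n : ℝ))) ^ 2 = 1 / 16 := by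
    rw [div_pow, mul_pow, Real.sq_sqrt (Nat.cast_nonneg _)]
    have : (n : ℝ) ≠ 0 := by exact_mod_cast NeZero.ne n
    field_simp; norm_num
  obtain ⟨e, f, τ, σ, h, hmass⟩ := exists_isNearOptimal ν u v hκ hx₀
  have hexp : 2 / (ε ^ 2 / 600 * (1 / (4 * √(n : ℝ)))) = 4800 * √n / ε ^ 2 := by
    field_simp; norm_num
  rw [hexp] at hmass
  have hν : 0 < ν.real Set.univ := by
    rw [measureReal_def, ENNReal.toReal_pos_iff]
    exact ⟨NeZero.pos _, measure_lt_top _ _⟩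
  have hpos : 0 < ν.real (halfSpacePair u v e f τ σ) := lt_of_lt_of_le (by positivity) hmass
  have hpos' := hpos
  rw [← halfSpacePair_swap] at hpos'
  refine ⟨halfSpacePair u v e f τ σ, measurableSet_halfSpacePair hu hv e f τ σ, hmass, ?_⟩
  rcases le_total τ σ with hτσ | hτσ
  · exact h.exists_rank_one_approx hu hv hu1 hv1 hκ (by linarith) hx₀ hε (by linarith) hpos
      (h.le_sq_offset hu hv hu1 hκ hκ1 hx₀ hn hnx hpos) hτσ
  · obtain ⟨L, hL, hL1, hL2⟩ := h.swap.exists_rank_one_approx hv hu hv1 hu1 hκ (by linarith) hx₀ hε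
      (by linarith) hpos' (h.swap.le_sq_offset hv hu hv1 hκ hκ1 hx₀ hn hnx hpos') hτσ
    rw [halfSpacePair_swap] at hL1 hL2
    refine ⟨L.transpose, by rw [Matrix.rank_transpose, hL], ?_, ?_⟩
    · rwa [Matrix.frobenius_norm_transpose]
    · rw [Matrix.frobenius_norm_transpose, ← Matrix.frobenius_norm_transpose]
      have htr : (L.transpose - Matrix.of fun i j =>
          ∫ ω in halfSpacePair u v e f τ σ, u ω i * v ω j ∂ν).transpose =
          L - Matrix.of fun i j => ∫ ω in halfSpacePair u v e f τ σ, v ω i * u ω j ∂ν := by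
        ext i j
        simp [mul_comm]
      rw [htr]
      exact hL2

/-! ### Random scales. -/

section Scale

variable {Ω : Type*} [MeasurableSpace Ω] {μ : Measure Ω} [IsProbabilityMeasure μ] {s : Ω → ℝ}

theorem cdf_map_eq_measureReal (hs : Measurable s) (t : ℝ) :
    ProbabilityTheory.cdf (μ.map s) t = μ.real {ω | s ω ≤ t} := by
  have := Measure.isProbabilityMeasure_map (μ := μ) hs.aemeasurable
  rw [ProbabilityTheory.cdf_eq_real, map_measureReal_apply hs measurableSet_Iic]
  rfl

/-- The distribution function may jump over `1/4`, so the crossing is located on a geometric grid of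
ratio `M`. -/
theorem exists_measureReal_le_lt_le (hs : Measurable s) (hpos : ∀ᵐ ω ∂μ, 0 < s ω) {M : ℝ}
    (hM : 1 < M) :
    ∃ t, 0 < t ∧ μ.real {ω | s ω ≤ t} < 1 / 4 ∧ 1 / 4 ≤ μ.real {ω | s ω ≤ M * t} := by
  simp_rw [← cdf_map_eq_measureReal (μ := μ) hs]
  set G := ProbabilityTheory.cdf (μ.map s)
  have h0 : G 0 = 0 := by
    rw [cdf_map_eq_measureReal hs, measureReal_eq_zero_iff, measure_eq_zero_iff_ae_notMem]
    filter_upwards [hpos] with ω hω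
    exact not_le.2 hω
  obtain ⟨t₀, ht₀, hGt₀⟩ : ∃ t₀, 0 < t₀ ∧ G t₀ < 1 / 4 := by
    have hcont := (G.right_continuous 0).mono_left (nhdsWithin_mono 0 Set.Ioi_subset_Ici_self)
    have hev : ∀ᶠ t in nhdsWithin 0 (Set.Ioi 0), G t < 1 / 4 :=
      hcont.eventually (gt_mem_nhds (by rw [h0]; norm_num))
    obtain ⟨t, ht, ht'⟩ := (hev.and self_mem_nhdsWithin).exists
    exact ⟨t, ht', ht⟩
  have hex : ∃ k : ℕ, 1 / 4 ≤ G (M ^ k * t₀) := by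
    have htop : Filter.Tendsto (fun k : ℕ => M ^ k * t₀) Filter.atTop Filter.atTop :=
      (tendsto_pow_atTop_atTop_of_one_lt hM).atTop_mul_const ht₀
    have := ((ProbabilityTheory.tendsto_cdf_atTop (μ.map s)).comp htop).eventually
      (lt_mem_nhds (by norm_num : (1 / 4 : ℝ) < 1))
    obtain ⟨k, hk⟩ := this.exists
    exact ⟨k, hk.le⟩
  classical
  have hk := Nat.find_spec hex
  have hk0 : Nat.find hex ≠ 0 := fun h => by
    rw [h, pow_zero, one_mul] at hk
    linarith
  obtain ⟨k, hk'⟩ := Nat.exists_eq_succ_of_ne_zero hk0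
  refine ⟨M ^ k * t₀, by positivity, not_le.1 (Nat.find_min hex (by omega)), ?_⟩
  rw [hk', pow_succ'] at hk
  rwa [← mul_assoc]

/-- Either a quarter of the mass has comparable scales, or a quarter lies on each side of a large
gap. -/
theorem exists_scale_dichotomy (hs : Measurable s) (hpos : ∀ᵐ ω ∂μ, 0 < s ω) {M : ℝ}
    (hM : 1 < M) :
    ∃ r, 0 < r ∧ (1 / 4 ≤ μ.real {ω | r < s ω ∧ s ω ≤ M ^ 2 * r} ∨
      (1 / 4 ≤ μ.real {ω | s ω ≤ r} ∧ ∃ T, 1 / 4 ≤ μ.real {ω | M * r < s ω ∧ s ω ≤ T})) := by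
  obtain ⟨t, ht, h1, h2⟩ := exists_measureReal_le_lt_le (μ := μ) hs hpos hM
  have hle : ∀ a b, μ.real {ω | s ω ≤ b} ≤
      μ.real {ω | s ω ≤ a} + μ.real {ω | a < s ω ∧ s ω ≤ b} := fun a b =>
    (measureReal_mono fun ω (hω : s ω ≤ b) => (le_or_gt (s ω) a).imp id fun h => ⟨h, hω⟩).trans
      (measureReal_union_le _ _)
  by_cases h3 : 1 / 4 ≤ μ.real {ω | t < s ω ∧ s ω ≤ M ^ 2 * t}
  · exact ⟨t, ht, Or.inl h3⟩
  -- Less than a quarter lies up to `t` and less than a quarter in the light window, so more than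
  -- half lies above `M² t`; `T` cuts off less than a quarter of it.
  refine ⟨M * t, by positivity, Or.inr ⟨h2, ?_⟩⟩
  have htop := (ProbabilityTheory.tendsto_cdf_atTop (μ.map s)).eventually
    (lt_mem_nhds (by norm_num : (3 / 4 : ℝ) < 1))
  obtain ⟨T, hT⟩ := htop.exists
  rw [cdf_map_eq_measureReal hs] at hT
  refine ⟨T, ?_⟩
  rw [← mul_assoc, ← sq]
  linarith [hle t (M ^ 2 * t), hle (M ^ 2 * t) T]

variable {n : ℕ} {u v : Ω → EuclideanSpace ℝ (Fin n)}

theorem integrableOn_scaled_entry (hs : Measurable s) (hs0 : ∀ ω, 0 ≤ s ω) (hu : Measurable u)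
    (hv : Measurable v) (hu1 : ∀ ω, ‖u ω‖ = 1) (hv1 : ∀ ω, ‖v ω‖ = 1) {G : Set Ω}
    (hG : MeasurableSet G) {T : ℝ} (hT : ∀ ω ∈ G, s ω ≤ T) (i j : Fin n) :
    IntegrableOn (fun ω => s ω * (u ω i * v ω j)) G μ := by
  refine Integrable.of_bound (hs.mul ((measurable_euclideanSpace_apply hu i).mul
    (measurable_euclideanSpace_apply hv j))).aestronglyMeasurable T ?_
  filter_upwards [ae_restrict_mem hG] with ω hω
  rw [norm_mul, Real.norm_of_nonneg (hs0 ω), norm_mul]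
  refine (mul_le_of_le_one_right (hs0 ω) (mul_le_one₀ ?_ (norm_nonneg _) ?_)).trans (hT ω hω)
  · exact (EuclideanSpace.abs_apply_le_norm _ _).trans (hu1 ω).le
  · exact (EuclideanSpace.abs_apply_le_norm _ _).trans (hv1 ω).le

/-- The rank-one approximation for `s u vᵀ` when the scale `s` is bounded above and below on an
event of probability at least a quarter. -/
theorem exists_event_rank_one_approx_of_scale (hn : 1 ≤ n) (hs : Measurable s)
    (hs0 : ∀ ω, 0 ≤ s ω) (hu : Measurable u)
    (hv : Measurable v) (hu1 : ∀ ω, ‖u ω‖ = 1) (hv1 : ∀ ω, ‖v ω‖ = 1)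
    {ε : ℝ} (hε : 0 < ε) (hε1 : ε ≤ 1) {l T : ℝ} (hl : 0 < l)
    (hB : 1 / 4 ≤ μ.real {ω | l < s ω ∧ s ω ≤ T}) :
    ∃ A, MeasurableSet A ∧ A ⊆ {ω | l < s ω ∧ s ω ≤ T} ∧
      Real.exp (-(4800 * √n / ε ^ 2)) / 32 * l ≤ T * μ.real A ∧
      ∃ L : Matrix (Fin n) (Fin n) ℝ, L.rank = 1 ∧
        1 / (4 * √n) * (Real.exp (-(4800 * √n / ε ^ 2)) / 32 * l) ≤ ‖L‖ ∧
        ‖L - Matrix.of fun i j => ∫ ω in A, s ω * (u ω i * v ω j) ∂μ‖ ≤ ε / 2 * ‖L‖ := by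
  set B := {ω | l < s ω ∧ s ω ≤ T} with hBdef
  have hBm : MeasurableSet B := by
    rw [hBdef, Set.ofPred_and]
    exact (measurableSet_lt measurable_const hs).inter (measurableSet_le hs measurable_const)
  have hsint : ∀ A, MeasurableSet A → A ⊆ B → IntegrableOn s A μ := fun A hA hAB => by
    refine Integrable.of_bound hs.aestronglyMeasurable T ?_
    filter_upwards [ae_restrict_mem hA] with ω hω
    rw [Real.norm_of_nonneg (hs0 ω)]
    exact (hAB hω).2
  -- Weighting by `s` turns moments of `s u vᵀ` into moments of `u vᵀ`. The bounds `l` and `T`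
  -- convert masses between `ν` and `μ`.
  set ν := (μ.restrict B).withDensity fun ω => ENNReal.ofReal (s ω) with hν
  have hfin : IsFiniteMeasure ν := isFiniteMeasure_withDensity_ofReal (hsint B hBm le_rfl).2
  have hint : ∀ A, MeasurableSet A → ∀ g : Ω → ℝ,
      ∫ ω in A, g ω ∂ν = ∫ ω in A ∩ B, s ω * g ω ∂μ := fun A hA g => by
    rw [hν, restrict_withDensity hA, Measure.restrict_restrict hA,
      integral_withDensity_eq_integral_toReal_smul hs.ennreal_ofReal
        (Filter.Eventually.of_forall fun _ => ENNReal.ofReal_lt_top)]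
    simp [ENNReal.toReal_ofReal (hs0 _)]
  have hreal : ∀ A, MeasurableSet A → ν.real A = ∫ ω in A ∩ B, s ω ∂μ := fun A hA => by
    simpa using hint A hA fun _ => 1
  have huniv : l / 4 ≤ ν.real Set.univ := by
    rw [hreal _ MeasurableSet.univ, Set.univ_inter]
    have := setIntegral_mono_on (μ := μ) (integrable_const l) (hsint B hBm le_rfl) hBm
      fun ω hω => hω.1.le
    simp only [integral_const, measureReal_restrict_apply_univ, smul_eq_mul] at this
    nlinarith
  have : NeZero ν := ⟨fun h => by
    rw [h] at huniv
    simp at huniv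
    linarith⟩
  obtain ⟨A, hA, hmass, L, hL, hL1, hL2⟩ :=
    exists_event_rank_one_approx hn ν hu hv hu1 hv1 hε hε1
  have hmass' : Real.exp (-(4800 * √n / ε ^ 2)) / 32 * l ≤ ν.real A := by
    refine le_trans ?_ hmass
    calc _ = Real.exp (-(4800 * √n / ε ^ 2)) / 8 * (l / 4) := by ring
      _ ≤ _ := mul_le_mul_of_nonneg_left huniv (by positivity)
  refine ⟨A ∩ B, hA.inter hBm, Set.inter_subset_right, hmass'.trans ?_, L, hL, ?_, ?_⟩
  · rw [hreal A hA]
    refine (setIntegral_mono_on (hsint _ (hA.inter hBm) Set.inter_subset_right)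
      (integrable_const T) (hA.inter hBm) fun ω hω => hω.2.2).trans_eq ?_
    simp [mul_comm]
  · exact (mul_le_mul_of_nonneg_left hmass' (by positivity)).trans hL1
  · simpa only [hint A hA] using hL2

theorem Matrix.frobenius_norm_le_of_entry_le {A : Matrix (Fin n) (Fin n) ℝ} {r : ℝ} (hr : 0 ≤ r)
    (hA : ∀ i j, |A i j| ≤ r) : ‖A‖ ≤ n * r := by
  refine abs_le_of_sq_le_sq' ?_ (by positivity) |>.2
  rw [Matrix.frobenius_norm_sq]
  calc ∑ i, ∑ j, A i j ^ 2 ≤ ∑ _i : Fin n, ∑ _j : Fin n, r ^ 2 :=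
        Finset.sum_le_sum fun i _ => Finset.sum_le_sum fun j _ => by
          rw [← sq_abs]; exact pow_le_pow_left₀ (abs_nonneg _) (hA i j) 2
    _ = (n * r) ^ 2 := by simp; ring

/-- Since `M` is `exp H` up to factors negligible in the exponent, the right side costs about `3 H =
14400 q / ε²`; the remaining 600 pays for those factors. -/
theorem exp_neg_le_exp_neg_div_sq {q ε H M : ℝ} (hq : 1 ≤ q) (hε : 0 < ε) (hε1 : ε ≤ 1)
    (hH : H = 4800 * q / ε ^ 2) (hM : M = 256 * q ^ 3 * Real.exp H / ε) :
    Real.exp (-(15000 * q / ε ^ 2)) ≤ Real.exp (-H) / (32 * M ^ 2) := by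
  have he : (2 : ℝ) ≤ Real.exp 1 := by linarith [Real.add_one_le_exp 1]
  have hpow : ∀ k : ℕ, (2 : ℝ) ^ k ≤ Real.exp k := fun k => by
    rw [← mul_one (k : ℝ), Real.exp_nat_mul]
    exact pow_le_pow_left₀ (by norm_num) he k
  have h256 : (256 : ℝ) ≤ Real.exp 8 := by
    simpa using (by norm_num : (256 : ℝ) = 2 ^ 8).trans_le (hpow 8)
  have h32 : (32 : ℝ) ≤ Real.exp 5 := by
    simpa using (by norm_num : (32 : ℝ) = 2 ^ 5).trans_le (hpow 5)
  have hq3 : q ^ 3 ≤ Real.exp (3 * q) := by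
    have := pow_le_pow_left₀ (by linarith) ((lt_add_one q).le.trans (Real.add_one_le_exp q)) 3
    rwa [← Real.exp_nat_mul] at this
  have hε' : 1 / ε ≤ Real.exp (1 / ε) := (lt_add_one _).le.trans (Real.add_one_le_exp _)
  have hM0 : 0 < M := by rw [hM]; positivity
  have hMle : M ≤ Real.exp (8 + 3 * q + H + 1 / ε) := by
    rw [Real.exp_add, Real.exp_add, Real.exp_add, hM, div_eq_mul_one_div]
    gcongr
  rw [le_div_iff₀ (by positivity)]
  have h1 : 32 * M ^ 2 ≤ Real.exp 5 * Real.exp (8 + 3 * q + H + 1 / ε) ^ 2 := by gcongr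
  refine (mul_le_mul_of_nonneg_left h1 (Real.exp_pos _).le).trans ?_
  rw [← Real.exp_nat_mul, ← Real.exp_add, ← Real.exp_add, Real.exp_le_exp]
  have hx : 1 ≤ 1 / ε := by rw [le_div_iff₀ hε]; linarith
  set x := 1 / ε with hxdef
  have hHx : H = 4800 * (q * x ^ 2) := by rw [hH, hxdef]; ring
  have hKx : 15000 * q / ε ^ 2 = 15000 * (q * x ^ 2) := by rw [hxdef]; ring
  have hxx : x ≤ x ^ 2 := by nlinarith
  have hb1 : q ≤ q * x ^ 2 := by nlinarith
  have hb2 : x ≤ q * x ^ 2 := by nlinarith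
  rw [hHx, hKx]
  push_cast
  nlinarith

/-- A random matrix `s u vᵀ` has an event of probability `exp (-O(√n / ε²))` on which its partial
expectation exists and is `ε`-close to a rank-one matrix. -/
theorem exists_event_scaled_rank_one_approx (hn : 1 ≤ n) (hs : Measurable s)
    (hs0 : ∀ ω, 0 ≤ s ω) (hpos : ∀ᵐ ω ∂μ, 0 < s ω) (hu : Measurable u)
    (hv : Measurable v) (hu1 : ∀ ω, ‖u ω‖ = 1) (hv1 : ∀ ω, ‖v ω‖ = 1)
    {ε : ℝ} (hε : 0 < ε) (hε1 : ε ≤ 1) :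
    ∃ G, MeasurableSet G ∧ Real.exp (-(15000 * √n / ε ^ 2)) ≤ μ.real G ∧
      (∃ T, ∀ ω ∈ G, s ω ≤ T) ∧
      ∃ L : Matrix (Fin n) (Fin n) ℝ, L.rank = 1 ∧
        ‖L - Matrix.of fun i j => ∫ ω in G, s ω * (u ω i * v ω j) ∂μ‖ ≤ ε * ‖L‖ := by
  have hq : 1 ≤ √(n : ℝ) := Real.one_le_sqrt.2 (by exact_mod_cast hn)
  have hq2 : √(n : ℝ) ^ 2 = n := Real.sq_sqrt (Nat.cast_nonneg _)
  obtain ⟨H, hH⟩ : ∃ H, H = 4800 * √(n : ℝ) / ε ^ 2 := ⟨_, rfl⟩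
  -- This `M` makes the contribution of scales up to `r`, at most `n r`, equal to `ε / 2` times the
  -- lower bound for `‖L‖` obtained above `M r`.
  obtain ⟨M, hM⟩ : ∃ M, M = 256 * √(n : ℝ) ^ 3 * Real.exp H / ε := ⟨_, rfl⟩
  have hcost := exp_neg_le_exp_neg_div_sq hq hε hε1 hH hM
  have hH0 : 0 ≤ H := by rw [hH]; positivity
  have hM1 : 1 < M := by
    rw [hM, lt_div_iff₀ hε]
    have h1 : 1 ≤ √(n : ℝ) ^ 3 := one_le_pow₀ hq
    have h2 : 1 ≤ √(n : ℝ) ^ 3 * Real.exp H :=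
      one_le_mul_of_one_le_of_one_le h1 (Real.one_le_exp hH0)
    linarith
  obtain ⟨r, hr, hB | ⟨hr4, T, hB⟩⟩ := exists_scale_dichotomy (μ := μ) hs hpos hM1
  · obtain ⟨A, hA, hAB, hmass, L, hL, -, hL2⟩ :=
      exists_event_rank_one_approx_of_scale hn hs hs0 hu hv hu1 hv1 hε hε1 hr hB
    refine ⟨A, hA, hcost.trans ?_, ⟨_, fun ω hω => (hAB hω).2⟩, L, hL, hL2.trans ?_⟩
    · rw [← hH] at hmass
      rw [div_le_iff₀ (by positivity)]
      have : Real.exp (-H) / 32 ≤ M ^ 2 * μ.real A :=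
        le_of_mul_le_mul_right (by linarith) hr
      linarith
    · nlinarith [norm_nonneg L]
  · obtain ⟨A, hA, hAB, -, L, hL, hL1, hL2⟩ :=
      exists_event_rank_one_approx_of_scale hn hs hs0 hu hv hu1 hv1 hε hε1
        (by positivity : 0 < M * r) hB
    set R := {ω | s ω ≤ r} with hR
    have hRm : MeasurableSet R := measurableSet_le hs measurable_const
    have hdisj : Disjoint R A := Set.disjoint_left.2 fun ω (hω : s ω ≤ r) hω' => by
      have := (hAB hω').1
      nlinarith
    -- `A` alone may be far too unlikely, since `T` is uncontrolled; adjoining `R` restores the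
    -- probability and perturbs the expectation by at most `n r`.
    refine ⟨R ∪ A, hRm.union hA, ?_, ⟨max r T, ?_⟩, L, hL, ?_⟩
    · refine le_trans (hcost.trans ?_) (hr4.trans (measureReal_mono Set.subset_union_left))
      rw [div_le_div_iff₀ (by positivity) (by norm_num)]
      have : Real.exp (-H) ≤ 1 := Real.exp_le_one_iff.2 (by linarith)
      nlinarith
    · rintro ω (hω | hω)
      · exact (show s ω ≤ r from hω).trans (le_max_left _ _)
      · exact (hAB hω).2.trans (le_max_right _ _)
    · have hsplit : L - (Matrix.of fun i j => ∫ ω in R ∪ A, s ω * (u ω i * v ω j) ∂μ) =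
          (L - Matrix.of fun i j => ∫ ω in A, s ω * (u ω i * v ω j) ∂μ) -
            Matrix.of fun i j => ∫ ω in R, s ω * (u ω i * v ω j) ∂μ := by
        ext i j
        simp only [Matrix.sub_apply, Matrix.of_apply]
        rw [setIntegral_union hdisj hA
          (integrableOn_scaled_entry hs hs0 hu hv hu1 hv1 hRm (fun ω hω => hω) i j)
          (integrableOn_scaled_entry hs hs0 hu hv hu1 hv1 hA (fun ω hω => (hAB hω).2) i j)]
        ring
      have hsmall : ‖Matrix.of fun i j => ∫ ω in R, s ω * (u ω i * v ω j) ∂μ‖ ≤ n * r := by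
        refine Matrix.frobenius_norm_le_of_entry_le hr.le fun i j => ?_
        have hb : ‖∫ ω in R, s ω * (u ω i * v ω j) ∂μ‖ ≤ r * μ.real R := by
          refine norm_setIntegral_le_of_norm_le_const (measure_lt_top _ _)
            fun ω (hω : s ω ≤ r) => ?_
          rw [norm_mul, Real.norm_of_nonneg (hs0 ω), norm_mul]
          refine (mul_le_of_le_one_right (hs0 ω) (mul_le_one₀ ?_ (norm_nonneg _) ?_)).trans hω
          · exact (EuclideanSpace.abs_apply_le_norm _ _).trans (hu1 ω).le
          · exact (EuclideanSpace.abs_apply_le_norm _ _).trans (hv1 ω).le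
        exact hb.trans (mul_le_of_le_one_right hr.le measureReal_le_one)
      have hnr : n * r = ε / 2 * (1 / (4 * √n) * (Real.exp (-H) / 32 * (M * r))) := by
        have he : Real.exp (-H) * Real.exp H = 1 := by rw [← Real.exp_add]; simp
        have : ε / 2 * (1 / (4 * √n) * (Real.exp (-H) / 32 * (M * r))) =
            √(n : ℝ) ^ 2 * r * (Real.exp (-H) * Real.exp H) := by
          rw [hM]; field_simp; norm_num
        rw [this, he, hq2, mul_one]
      rw [← hH] at hL1
      have := mul_le_mul_of_nonneg_left hL1 (by positivity : 0 ≤ ε / 2)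
      rw [← hnr] at this
      rw [hsplit]
      refine (norm_sub_le _ _).trans ?_
      linarith

end Scale

/-! ### Divergence of a conditioned measure. -/

/-- Conditioning on an event of probability `p` has Kullback-Leibler divergence `-log p`. -/
theorem klDiv_cond_le {Ω : Type*} [MeasurableSpace Ω] {μ : Measure Ω} [IsProbabilityMeasure μ]
    {G : Set Ω} (hG : MeasurableSet G) (h0 : μ G ≠ 0) :
    InformationTheory.klDiv (ProbabilityTheory.cond μ G) μ ≤
      ENNReal.ofReal (-Real.log (μ.real G)) := by
  have hprob : IsProbabilityMeasure (ProbabilityTheory.cond μ G) :=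
    ProbabilityTheory.cond_isProbabilityMeasure h0
  have hac : ProbabilityTheory.cond μ G ≪ μ := ProbabilityTheory.cond_absolutelyContinuous
  have hder : (ProbabilityTheory.cond μ G).rnDeriv μ =ᵐ[μ] (μ G)⁻¹ • G.indicator 1 := by
    rw [ProbabilityTheory.cond]
    exact (Measure.rnDeriv_smul_left_of_ne_top _ _ (ENNReal.inv_ne_top.2 h0)).trans
      ((Measure.rnDeriv_restrict_self μ hG).const_smul _)
  have hllr : llr (ProbabilityTheory.cond μ G) μ =ᵐ[ProbabilityTheory.cond μ G]
      fun _ => -Real.log (μ.real G) := by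
    filter_upwards [hac.ae_le hder, ProbabilityTheory.ae_cond_mem hG] with ω hω hmem
    rw [llr, hω]
    simp [hmem, ENNReal.toReal_inv, measureReal_def]
  rw [InformationTheory.klDiv_of_ac_of_integrable hac
    ((integrable_congr hllr).2 (integrable_const _)), integral_congr_ae hllr]
  simp

/-! ### Measurable factorization of rank-one matrices. -/

section UnitFactors

variable {n : ℕ}

theorem measurable_matrix_apply (i j : Fin n) :
    Measurable fun X : Matrix (Fin n) (Fin n) ℝ => X i j :=
  (measurable_pi_apply j).comp (measurable_pi_apply (X := fun _ => Fin n → ℝ) i)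

theorem measurable_toLp_of_apply {Ω : Type*} [MeasurableSpace Ω] {g : Ω → Fin n → ℝ}
    (hg : ∀ i, Measurable fun ω => g ω i) :
    Measurable fun ω => (WithLp.toLp 2 (g ω) : EuclideanSpace ℝ (Fin n)) :=
  (PiLp.continuous_toLp 2 fun _ : Fin n => ℝ).measurable.comp (measurable_pi_iff.2 hg)

theorem measurable_frobenius_norm :
    Measurable fun X : Matrix (Fin n) (Fin n) ℝ => ‖X‖ := by
  have : (fun X : Matrix (Fin n) (Fin n) ℝ => ‖X‖) = fun X => √(∑ i, ∑ j, X i j ^ 2) := by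
    ext X
    rw [← Matrix.frobenius_norm_sq, Real.sqrt_sq (norm_nonneg _)]
  rw [this]
  exact (Finset.measurable_sum _ fun i _ => Finset.measurable_sum _ fun j _ =>
    (measurable_matrix_apply i j).pow_const 2).sqrt

/-- A map to the unit sphere that normalizes nonzero vectors. -/
theorem exists_measurable_normalize (hn : 1 ≤ n) :
    ∃ g : EuclideanSpace ℝ (Fin n) → EuclideanSpace ℝ (Fin n), Measurable g ∧
      (∀ x, ‖g x‖ = 1) ∧ ∀ x, x = ‖x‖ • g x := by
  classical
  have : NeZero n := ⟨by omega⟩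
  obtain ⟨e, he⟩ := exists_norm_eq (EuclideanSpace ℝ (Fin n)) zero_le_one
  refine ⟨fun x => if x = 0 then e else ‖x‖⁻¹ • x,
    Measurable.ite (measurableSet_singleton 0) measurable_const
      (measurable_norm.inv.smul measurable_id), fun x => ?_, fun x => ?_⟩
  · by_cases hx : x = 0
    · simp [hx, he]
    · simp [hx, norm_smul]
  · by_cases hx : x = 0
    · simp [hx]
    · simp [hx, smul_smul]

/-- A rank-one matrix is determined by any nonzero multiple of one of its rows. -/
theorem Matrix.exists_eq_mul_of_rank_eq_one {X : Matrix (Fin n) (Fin n) ℝ} (hX : X.rank = 1)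
    {i₀ : Fin n} (hi₀ : X i₀ ≠ 0) : ∀ i, ∃ c : ℝ, X i = c • X i₀ := by
  intro i
  rw [Matrix.rank_eq_finrank_span_row] at hX
  have hmem : ∀ k, X k ∈ Submodule.span ℝ (Set.range X.row) := fun k =>
    Submodule.subset_span ⟨k, rfl⟩
  obtain ⟨c, hc⟩ := (finrank_eq_one_iff_of_nonzero'
    (⟨X i₀, hmem i₀⟩ : Submodule.span ℝ (Set.range X.row))
    (fun h => hi₀ (congrArg Subtype.val h))).1 hX ⟨X i, hmem i⟩
  exact ⟨c, (congrArg Subtype.val hc).symm⟩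

theorem exists_measurable_unit_row (hn : 1 ≤ n) :
    ∃ v : Matrix (Fin n) (Fin n) ℝ → EuclideanSpace ℝ (Fin n), Measurable v ∧
      (∀ X, ‖v X‖ = 1) ∧ ∀ X, X ≠ 0 → ∃ i, X i ≠ 0 ∧ ∃ c : ℝ, X i = c • (v X : Fin n → ℝ) := by
  classical
  obtain ⟨g, hg, hg1, hgx⟩ := exists_measurable_normalize hn
  let row : ℕ → Matrix (Fin n) (Fin n) ℝ → EuclideanSpace ℝ (Fin n) := fun k X =>
    if h : k < n then WithLp.toLp 2 (X ⟨k, h⟩) else 0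
  have hrow : ∀ k, Measurable (row k) := fun k => by
    by_cases h : k < n
    · simp only [row, h, dif_pos]
      exact measurable_toLp_of_apply fun j => measurable_matrix_apply _ j
    · simp only [row, h, dif_neg, not_false_eq_true]
      exact measurable_const
  -- The search picks the first nonzero row; the alternative `n ≤ k` makes it end even at `X = 0`.
  let p : ℕ → Matrix (Fin n) (Fin n) ℝ → Prop := fun k X => row k X ≠ 0 ∨ n ≤ k
  have hp : ∀ k, MeasurableSet {X | p k X} := fun k => by
    simp only [p, Set.ofPred_or]
    exact ((hrow k) (measurableSet_singleton 0)).compl.union (MeasurableSet.const _)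
  have hex : ∀ X, ∃ k, p k X := fun X => ⟨n, Or.inr le_rfl⟩
  refine ⟨fun X => g (row (Nat.find (hex X)) X),
    Measurable.find (fun k => hg.comp (hrow k)) hp hex, fun X => hg1 _, fun X hX => ?_⟩
  obtain ⟨i, hi⟩ : ∃ i, X i ≠ 0 := by
    by_contra! h
    exact hX (funext h)
  have hpi : p i X := Or.inl (by simpa [row] using hi)
  have hlt : Nat.find (hex X) < n := (Nat.find_min' (hex X) hpi).trans_lt i.2
  have hne : row (Nat.find (hex X)) X ≠ 0 :=
    (Nat.find_spec (hex X)).resolve_right (not_le.2 hlt)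
  have hrow_eq : row (Nat.find (hex X)) X = WithLp.toLp 2 (X ⟨Nat.find (hex X), hlt⟩) :=
    dif_pos hlt
  refine ⟨⟨Nat.find (hex X), hlt⟩, fun h => hne ?_, ‖row (Nat.find (hex X)) X‖, ?_⟩
  · rw [hrow_eq, h]; rfl
  · have := hgx (row (Nat.find (hex X)) X)
    ext j
    have h2 := congrArg (fun x : EuclideanSpace ℝ (Fin n) => x j) this
    nth_rewrite 1 [hrow_eq] at h2
    simpa using h2

/-- Rank-one matrices factor measurably as `‖X‖ u vᵀ` with unit vectors `u` and `v`. -/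
theorem exists_measurable_unit_factors (hn : 1 ≤ n) :
    ∃ u v : Matrix (Fin n) (Fin n) ℝ → EuclideanSpace ℝ (Fin n), Measurable u ∧ Measurable v ∧
      (∀ X, ‖u X‖ = 1) ∧ (∀ X, ‖v X‖ = 1) ∧
      ∀ X, X.rank = 1 → ∀ i j, X i j = ‖X‖ * (u X i * v X j) := by
  obtain ⟨g, hg, hg1, hgx⟩ := exists_measurable_normalize hn
  obtain ⟨v, hv, hv1, hvX⟩ := exists_measurable_unit_row hn
  -- Every row is a multiple of the unit vector `v`, so `X = (X v) vᵀ`.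
  let w : Matrix (Fin n) (Fin n) ℝ → EuclideanSpace ℝ (Fin n) := fun X =>
    WithLp.toLp 2 fun i => ∑ j, X i j * v X j
  have hw : Measurable w := measurable_toLp_of_apply fun i => Finset.measurable_sum _ fun j _ =>
    (measurable_matrix_apply i j).mul (measurable_euclideanSpace_apply hv j)
  refine ⟨fun X => g (w X), v, hg.comp hw, hv, fun X => hg1 _, hv1, fun X hX => ?_⟩
  have hvsum : ∑ j, v X j ^ 2 = 1 := by
    rw [← EuclideanSpace.real_norm_sq_eq, hv1, one_pow]
  have hX0 : X ≠ 0 := fun h => by simp [h] at hX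
  obtain ⟨i₀, hi₀, c₀, hc₀⟩ := hvX X hX0
  have hrow : ∀ i j, X i j = w X i * v X j := fun i j => by
    obtain ⟨c, hc⟩ := Matrix.exists_eq_mul_of_rank_eq_one hX hi₀ i
    have hij : ∀ j, X i j = c * c₀ * v X j := fun j => by
      rw [hc, hc₀]; simp [mul_assoc]
    have hwi : w X i = c * c₀ := by
      have hsum : ∑ j, X i j * v X j = ∑ j, c * c₀ * v X j ^ 2 :=
        Finset.sum_congr rfl fun j _ => by rw [hij j]; ring
      exact hsum.trans (by rw [← Finset.mul_sum, hvsum, mul_one])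
    rw [hij, hwi]
  have hnorm : ‖X‖ = ‖w X‖ := by
    refine (pow_left_inj₀ (norm_nonneg _) (norm_nonneg _) two_ne_zero).1 ?_
    rw [Matrix.frobenius_norm_sq, EuclideanSpace.real_norm_sq_eq]
    simp_rw [hrow, mul_pow, ← Finset.mul_sum, hvsum, mul_one]
  intro i j
  have h2 := congrArg (fun x : EuclideanSpace ℝ (Fin n) => x i) (hgx (w X))
  simp only [PiLp.smul_apply, smul_eq_mul] at h2
  rw [hrow, hnorm, ← mul_assoc, ← h2]

end UnitFactors

/-! ### Conclusion by conditioning. -/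

theorem theorem2p3 :
    ∃ p : Polynomial ℝ, ∀ (n : ℕ) (ε : ℝ), 0 < ε →
      ∀ μ : Measure (Matrix (Fin n) (Fin n) ℝ), IsProbabilityMeasure μ →
        (∀ᵐ X ∂μ, X.rank = 1) →
        ∃ μ' : Measure (Matrix (Fin n) (Fin n) ℝ),
          IsDeficientReweighting (Real.sqrt n * p.eval (1 / ε)) μ' μ ∧
          HasMeanMatrix μ' ∧
          ∃ L : Matrix (Fin n) (Fin n) ℝ, L.rank = 1 ∧
            ‖L - meanMatrix μ'‖ ≤ ε * ‖L‖ := by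
  -- The event is built for `δ = min ε 1`, and `1 / δ ≤ 1 + 1 / ε` explains the `1 + X`.
  refine ⟨15000 * (1 + Polynomial.X) ^ 2, fun n ε hε μ hμ hrank => ?_⟩
  have hn : 1 ≤ n := by
    obtain ⟨X, hX⟩ := hrank.exists
    have := X.rank_le_width
    omega
  set δ := min ε 1 with hδdef
  have hδ : 0 < δ := lt_min hε one_pos
  obtain ⟨u, v, hu, hv, hu1, hv1, hX⟩ := exists_measurable_unit_factors hn
  have hpos : ∀ᵐ X ∂μ, 0 < ‖X‖ := by
    filter_upwards [hrank] with X hX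
    exact norm_pos_iff.2 fun h => by simp [h] at hX
  obtain ⟨G, hG, hmass, ⟨T, hT⟩, L, hL, hLG⟩ := exists_event_scaled_rank_one_approx (μ := μ) hn
    measurable_frobenius_norm (fun X => norm_nonneg X) hpos hu hv hu1 hv1 hδ (min_le_right _ _)
  have hGpos : 0 < μ.real G := (Real.exp_pos _).trans_le hmass
  have hG0 : μ G ≠ 0 := fun h => by simp [measureReal_def, h] at hGpos
  have hentry : ∀ i j, (fun X : Matrix (Fin n) (Fin n) ℝ => X i j) =ᵐ[μ.restrict G]
      fun X => ‖X‖ * (u X i * v X j) := fun i j => by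
    filter_upwards [ae_restrict_of_ae hrank] with X h
    exact hX X h i j
  have hmean : meanMatrix (ProbabilityTheory.cond μ G) = (μ.real G)⁻¹ •
      Matrix.of fun i j => ∫ X in G, ‖X‖ * (u X i * v X j) ∂μ := by
    ext i j
    simp only [meanMatrix, Matrix.of_apply, Matrix.smul_apply, ProbabilityTheory.cond]
    rw [integral_smul_measure, integral_congr_ae (hentry i j), ENNReal.toReal_inv, measureReal_def]
  refine ⟨ProbabilityTheory.cond μ G,
    ⟨ProbabilityTheory.cond_isProbabilityMeasure hG0, (klDiv_cond_le hG hG0).trans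
      (ENNReal.ofReal_le_ofReal ?_)⟩, fun i j => ?_, (μ.real G)⁻¹ • L, ?_, ?_⟩
  · have hlog := (Real.le_log_iff_exp_le hGpos).2 hmass
    have hδ' : 1 / δ ≤ 1 + 1 / ε := by
      rcases min_choice ε 1 with h | h
      · rw [hδdef, h]; linarith
      · rw [hδdef, h]
        have : 0 < 1 / ε := by positivity
        linarith
    have hsq : (1 / δ) ^ 2 ≤ (1 + 1 / ε) ^ 2 := pow_le_pow_left₀ (by positivity) hδ' 2
    have heval : (15000 * (1 + Polynomial.X) ^ 2 : Polynomial ℝ).eval (1 / ε) =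
        15000 * (1 + 1 / ε) ^ 2 := by simp
    rw [heval]
    calc -Real.log (μ.real G) ≤ 15000 * √n / δ ^ 2 := by linarith
      _ = √n * (15000 * (1 / δ) ^ 2) := by ring
      _ ≤ √n * (15000 * (1 + 1 / ε) ^ 2) := by gcongr
  · rw [ProbabilityTheory.cond]
    refine Integrable.smul_measure ?_ (ENNReal.inv_ne_top.2 hG0)
    exact (integrable_congr (hentry i j)).2 (integrableOn_scaled_entry measurable_frobenius_norm
      (fun X => norm_nonneg X) hu hv hu1 hv1 hG hT i j)
  · rw [Matrix.rank_smul_of_mem_nonZeroDivisors _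
      (mem_nonZeroDivisors_of_ne_zero (inv_ne_zero hGpos.ne')), hL]
  · let := Matrix.frobeniusNormedSpace (R := ℝ) (m := Fin n) (n := Fin n) (α := ℝ)
    rw [hmean, ← smul_sub, norm_smul, norm_smul, mul_left_comm]
    refine mul_le_mul_of_nonneg_left (hLG.trans ?_) (norm_nonneg _)
    exact mul_le_mul_of_nonneg_right (min_le_left _ _) (norm_nonneg _)
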